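/- Let $L$ be a first-order language, let $\kappa$ be a cardinal with $\kappa>2^{|L|+\aleph_0}$, and let $\mathcal M$ be a $\kappa$-saturated $L$-structure whose theory is NIP. "Definable" means definable with parameters from $\mathcal M$, and "bounded" means of cardinality less than $\kappa$; a type-definable set is an intersection of boundedly many definable sets. Let $\mathcal U$ be an abelian $\bigvee$-definable group: an abelian group whose underlying set is a directed union $\mathcal U=\bigcup_{i\in I}X_i$ of boundedly many definable subsets $X_i$ of $M^n$, for a fixed $n$, such that for all $i,j\in I$ the restriction of the multiplication to $X_i\times X_j$ is definable. A definable set $X\subseteq\mathcal U$ is called generic if boundedly many translates of $X$ cover $\mathcal U$, and $\mathrm{Stab}_{ng}(X)=\{g\in\mathcal U : gX\,\triangle\,X \text{ is non-generic}\}$. **Theorem.** Assume that the non-generic definable subsets of $\mathcal U$ form an ideal and that $\mathcal U$ contains some definable generic set. Then for every definable generic set $X\subseteq\mathcal U$, the set $\mathrm{Stab}_{ng}(X)$ is a type-definable subgroup of $\mathcal U$ of bounded index. In particular $\mathcal U^{00}$ exists: there is a smallest type-definable subgroup of $\mathcal U$ of bounded index, and it is contained in a definable subset of $\mathcal U$.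 -/

import Mathlib

open Cardinal FirstOrder
open scoped Pointwise

universe u v w

namespace VDef

section Structure

variable (L : FirstOrder.Language.{u, v}) (M : Type w) [L.Structure M]

/-- `M` is `κ`-saturated: every set of formulas in finitely many variables, with parameters from a
set `A ⊆ M` of fewer than `κ` elements, which is finitely satisfiable in `M` is realized in `M`. -/
def IsSaturated (κ : Cardinal.{w}) : Prop :=
  ∀ (A : Set M), #A < κ → ∀ (m : ℕ) (p : Set (L[[A]].Formula (Fin m))),
    (∀ q : Finset (L[[A]].Formula (Fin m)), (q : Set (L[[A]].Formula (Fin m))) ⊆ p →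
      ∃ x : Fin m → M, ∀ φ ∈ q, φ.Realize x) →
    ∃ x : Fin m → M, ∀ φ ∈ p, φ.Realize x

/-- `M` is an NIP structure: for every formula `φ(x; y)` there is a size `N` for which no `N` tuples
`a i` are shattered by `φ`. Having shattered families of every finite size is expressed by
sentences, so this is a property of the theory of `M`. -/
def IsNIP : Prop :=
  ∀ (m k : ℕ) (φ : L.Formula (Fin m ⊕ Fin k)), ∃ N : ℕ,
    ¬ ∃ (a : Fin N → Fin m → M) (b : Set (Fin N) → Fin k → M),
      ∀ (i : Fin N) (S : Set (Fin N)), φ.Realize (Sum.elim (a i) (b S)) ↔ i ∈ S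

variable {M}

/-- Definable, with arbitrary parameters from `M`. -/
def IsDefinable {α : Type} (S : Set (α → M)) : Prop :=
  (Set.univ : Set M).Definable L S

/-- Type-definable: an intersection of fewer than `κ` definable sets. -/
def IsTypeDefinable (κ : Cardinal.{w}) {α : Type} (S : Set (α → M)) : Prop :=
  ∃ (ι : Type w) (D : ι → Set (α → M)),
    #ι < κ ∧ (∀ i, IsDefinable L (D i)) ∧ S = ⋂ i, D i

/-- The group with underlying set `U ⊆ M ^ n` is `⋁`-definable: `U` is a directed union of fewer
than `κ` definable sets `X i`, and the graph of the multiplication restricted to each `X i × X j`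
is definable. -/
def IsVDefinableGroup (κ : Cardinal.{w}) {n : ℕ} (U : Set (Fin n → M)) [Group U] : Prop :=
  ∃ (ι : Type w) (X : ι → Set (Fin n → M)),
    #ι < κ ∧ (∀ i, IsDefinable L (X i)) ∧ Directed (· ⊆ ·) X ∧ U = ⋃ i, X i ∧
    ∀ i j, IsDefinable L
      {z : Fin n ⊕ Fin n ⊕ Fin n → M | ∃ a b : U, (a : Fin n → M) ∈ X i ∧ (b : Fin n → M) ∈ X j ∧
        z = Sum.elim (a : Fin n → M) (Sum.elim (b : Fin n → M) ((a * b : U) : Fin n → M))}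

end Structure

section Group

variable (L : FirstOrder.Language.{u, v}) {M : Type w} [L.Structure M] (κ : Cardinal.{w})
variable {n : ℕ} {U : Set (Fin n → M)}

/-- A subset of `U` is definable if it is definable as a subset of `M ^ n`. -/
def IsDefinableIn (X : Set U) : Prop :=
  IsDefinable L ((fun g : U => (g : Fin n → M)) '' X)

/-- A subset of `U` is type-definable if it is type-definable as a subset of `M ^ n`. -/
def IsTypeDefinableIn (X : Set U) : Prop :=
  IsTypeDefinable L κ ((fun g : U => (g : Fin n → M)) '' X)

variable [Group U]

/-- Fewer than `κ` left translates of `X` cover `U`. -/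
def IsLeftGeneric (X : Set U) : Prop :=
  ∃ A : Set U, #A < κ ∧ (⋃ g ∈ A, g • X) = Set.univ

/-- Fewer than `κ` right translates of `X` cover `U`. -/
def IsRightGeneric (X : Set U) : Prop :=
  ∃ A : Set U, #A < κ ∧ (⋃ g ∈ A, MulOpposite.op g • X) = Set.univ

/-- Generic: both left-generic and right-generic. -/
def IsGeneric (X : Set U) : Prop :=
  IsLeftGeneric κ X ∧ IsRightGeneric κ X

/-- The definable non-generic subsets of `U` form an ideal in the Boolean ring of definable
subsets of `U`. -/
structure NonGenericIdeal (U : Set (Fin n → M)) [Group U] : Prop where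
  empty : ¬ IsGeneric κ (∅ : Set U)
  mono : ∀ X Y : Set U, IsDefinableIn L X → IsDefinableIn L Y → Y ⊆ X →
    ¬ IsGeneric κ X → ¬ IsGeneric κ Y
  union : ∀ X Y : Set U, IsDefinableIn L X → IsDefinableIn L Y →
    ¬ IsGeneric κ X → ¬ IsGeneric κ Y → ¬ IsGeneric κ (X ∪ Y)

/-- `Stab_ng(X)`, the set of `g` for which the symmetric difference of `gX` and `X` is
non-generic. -/
def stabNG (X : Set U) : Set U :=
  {g | ¬ IsGeneric κ (symmDiff (g • X) X)}

/-- `H` has bounded index: fewer than `κ` cosets. -/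
def HasBoundedIndex (H : Subgroup U) : Prop :=
  #(U ⧸ H) < κ

/-- `H` is `U^00`: the smallest type-definable subgroup of bounded index. It is required to be
contained in a definable subset of `U`. -/
structure IsU00 (H : Subgroup U) : Prop where
  typeDefinable : IsTypeDefinableIn L κ (H : Set U)
  subset_definable : ∃ Y : Set U, IsDefinableIn L Y ∧ (H : Set U) ⊆ Y
  boundedIndex : HasBoundedIndex κ H
  le : ∀ K : Subgroup U, IsTypeDefinableIn L κ (K : Set U) → HasBoundedIndex κ K → H ≤ K

end Group

end VDef

/-! The heart of the matter is bounded index; an invariant measure together with NIP gives it.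
Abelian groups have polynomial growth, so any nonempty set `X` carries a mean `μ`: an ultralimit of
counting measures on finite subsets of `X`, with `μ X = 1`, under which translating a subset of `X`
does not increase its measure (`exists_almost_invariant`, `exists_isMean`). By compactness finitely
many translates of a generic definable `W ⊆ X` cover a definable `X`, so `μ W > 0`
(`pos_of_isGeneric`). Hence definable sets of measure zero are non-generic.

Under NIP, a uniformly definable family is totally bounded for the distance `μ (symmDiff Y Z)`:
Sauer–Shelah and random sampling bound the size of a separated subfamily
(`exists_density_symmDiff_lt`). So, for each formula, countable data determine a set up to measure
zero, and also the action of a group element on the whole family up to measure zero. There are at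
most `|L| + ℵ₀` formulas, hence at most `2 ^ (|L| + ℵ₀) < κ` data in all. If `g` and `g'` in a
generic set `V` share their data, then `g⁻¹ * g'` lies in `Stab_ng(X)` for every generic definable
`X ⊆ V`. Thus even the intersection `stabInf` of all these stabilizers has bounded index.

Type-definability needs no measure: for `W` inside a definable generic `Y`, being non-generic means
that no finite number of translates of `W` covers `Y`, a countable conjunction of definable
conditions (`stabNG_eq_iInter`). The same coding leaves boundedly many stabilizers, so `stabInf` is
type-definable.

For minimality, let `K` be type-definable of bounded index. Any definable set containing `K`
contains some `Y * Y⁻¹` with `Y` definable and `K ⊆ Y`. Then `Y` is generic, and by the ideal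
property some translate of a piece of `Y` is a generic subset `X` of `V`. Now `stabInf ⊆ Stab_ng(X)
⊆ X * X⁻¹ ⊆ Y * Y⁻¹`. -/

namespace VDef

/-! ### Counting densities. -/

open scoped Classical in
/-- The proportion of points of the finite set `P` that lie in `W`. -/
noncomputable def density {G : Type*} (P : Finset G) (W : Set G) : ℝ :=
  (P.filter (· ∈ W)).card / P.card

section Density

variable {G : Type*} {P : Finset G}

theorem density_nonneg (P : Finset G) (W : Set G) : 0 ≤ density P W := by
  unfold density; positivity

theorem density_le_one (P : Finset G) (W : Set G) : density P W ≤ 1 := by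
  classical
  unfold density
  exact div_le_one_of_le₀ (by exact_mod_cast Finset.card_filter_le _ _) (by positivity)

theorem density_mono (P : Finset G) {V W : Set G} (h : V ⊆ W) : density P V ≤ density P W := by
  classical
  unfold density
  gcongr

theorem density_union_le (P : Finset G) (V W : Set G) :
    density P (V ∪ W) ≤ density P V + density P W := by
  classical
  unfold density
  rw [← add_div]
  gcongr
  exact_mod_cast (Finset.card_le_card fun x hx => by
    simpa only [Finset.mem_union, Finset.mem_filter, Set.mem_union, and_or_left] using hx).trans
      (Finset.card_union_le _ _)

theorem density_eq_one (hP : P.Nonempty) {W : Set G} (h : ↑P ⊆ W) : density P W = 1 := by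
  classical
  unfold density
  rw [Finset.filter_true_of_mem (fun x hx => h hx)]
  exact div_self (by exact_mod_cast hP.card_pos.ne')

end Density

/-! ### Polynomial growth and almost invariant finite sets. -/

section Growth

variable {G : Type*} [CommGroup G]

open scoped Classical in
/-- Products of elements of `S` with exponents of absolute value at most `n`. -/
noncomputable def cube (S : Finset G) (n : ℕ) : Finset G :=
  (Fintype.piFinset fun _ : S => Finset.Icc (-n : ℤ) n).image fun e => ∏ g : S, (g : G) ^ e g

theorem mem_cube {S : Finset G} {n : ℕ} {x : G} :
    x ∈ cube S n ↔ ∃ e : S → ℤ, (∀ g, -(n : ℤ) ≤ e g ∧ e g ≤ n) ∧ ∏ g : S, (g : G) ^ e g = x := by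
  classical
  simp [cube]

theorem card_cube_le (S : Finset G) (n : ℕ) : (cube S n).card ≤ (2 * n + 1) ^ S.card := by
  classical
  refine Finset.card_image_le.trans ?_
  simp only [Fintype.card_piFinset, Int.card_Icc, Finset.prod_const, Finset.card_univ,
    Fintype.card_coe]
  gcongr
  omega

theorem one_mem_cube (S : Finset G) (n : ℕ) : 1 ∈ cube S n :=
  mem_cube.2 ⟨0, by simp, by simp⟩

theorem cube_subset_succ (S : Finset G) (n : ℕ) : cube S n ⊆ cube S (n + 1) := by
  intro x hx
  obtain ⟨e, he, rfl⟩ := mem_cube.1 hx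
  exact mem_cube.2 ⟨e, fun g => ⟨by have := he g; push_cast; omega, by have := he g; push_cast; omega⟩,
    rfl⟩

theorem inv_mul_mem_cube {S : Finset G} {n : ℕ} {x g : G} (hg : g ∈ S) (hx : x ∈ cube S n) :
    g⁻¹ * x ∈ cube S (n + 1) := by
  classical
  obtain ⟨e, he, rfl⟩ := mem_cube.1 hx
  refine mem_cube.2 ⟨fun h => e h + if h = ⟨g, hg⟩ then -1 else 0, fun h => ?_, ?_⟩
  · have := he h
    push_cast
    split_ifs <;> constructor <;> omega
  · simp_rw [zpow_add, Finset.prod_mul_distrib]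
    rw [mul_comm]
    congr 1
    rw [Finset.prod_eq_single ⟨g, hg⟩] <;> simp +contextual

/-- Otherwise `c` would grow by a factor above `1 + δ` at every step, and exponential growth
contradicts the polynomial bound. -/
theorem exists_le_mul_of_le_pow {c : ℕ → ℕ} (h0 : 1 ≤ c 0) {r : ℕ}
    (hc : ∀ n, c n ≤ (2 * n + 1) ^ r) {δ : ℝ} (hδ : 0 < δ) :
    ∃ n, (c (n + 1) : ℝ) ≤ (1 + δ) * c n := by
  by_contra! H
  have h1 : ∀ n, (1 + δ) ^ n ≤ c n := by
    intro n
    induction n with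
    | zero => simpa using h0
    | succ n ih =>
      calc (1 + δ) ^ (n + 1) = (1 + δ) * (1 + δ) ^ n := by ring
        _ ≤ (1 + δ) * c n := by gcongr
        _ ≤ _ := (H n).le
  have ht := tendsto_pow_const_div_const_pow_of_one_lt r (show 1 < 1 + δ by linarith)
  have h2 : ∀ᶠ n : ℕ in Filter.atTop, (n : ℝ) ^ r / (1 + δ) ^ n < 1 / 3 ^ r :=
    ht.eventually (gt_mem_nhds (by positivity))
  obtain ⟨n, hn, hn1⟩ := (h2.and (Filter.eventually_ge_atTop 1)).exists
  have hpos : (0 : ℝ) < (1 + δ) ^ n := by positivity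
  rw [div_lt_div_iff₀ hpos (by positivity), one_mul, ← mul_pow] at hn
  have h3 : (c n : ℝ) ≤ (2 * n + 1) ^ r := by exact_mod_cast hc n
  have h4 : ((2 : ℝ) * n + 1) ^ r ≤ (n * 3) ^ r := by
    have : (1 : ℝ) ≤ n := by exact_mod_cast hn1
    gcongr
    linarith
  linarith [h1 n]

/-- Finite subsets of `X` whose counting measure is almost invariant. -/
theorem exists_almost_invariant (S : Finset G) {X : Set G} (hX : X.Nonempty) {δ : ℝ} (hδ : 0 < δ) :
    ∃ P : Finset G, P.Nonempty ∧ ↑P ⊆ X ∧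
      ∀ g ∈ S, ∀ W ⊆ X, density P (g • W) ≤ density P W + δ := by
  classical
  obtain ⟨x₀, hx₀⟩ := hX
  -- A translated cube cut down to `X`; the translation by `x₀` only serves to make it nonempty.
  -- Cutting down keeps the polynomial growth, and the `n` chosen below is one where passing to `n +
  -- 1` adds at most `δ * (P n).card` points.
  let P : ℕ → Finset G := fun n => (x₀ • cube S n).filter (· ∈ X)
  have hmem : ∀ n y, y ∈ P n ↔ x₀⁻¹ * y ∈ cube S n ∧ y ∈ X := by
    intro n y
    simp only [P, Finset.mem_filter, ← Finset.inv_smul_mem_iff, smul_eq_mul]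
  have hmono : ∀ n, P n ⊆ P (n + 1) := fun n y hy =>
    (hmem _ _).2 ⟨cube_subset_succ _ _ ((hmem _ _).1 hy).1, ((hmem _ _).1 hy).2⟩
  have hne : ∀ n, (P n).Nonempty := fun n =>
    ⟨x₀, (hmem _ _).2 ⟨by simpa using one_mem_cube S n, hx₀⟩⟩
  obtain ⟨n, hn⟩ := exists_le_mul_of_le_pow (c := fun n => (P n).card) (hne 0).card_pos (r := S.card)
    (fun n => (Finset.card_filter_le _ _).trans
      ((Finset.card_smul_finset x₀ (cube S n)).le.trans (card_cube_le S n))) hδ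
  refine ⟨P n, hne n, fun y hy => ((hmem _ _).1 hy).2, fun g hg W hW => ?_⟩
  have hpos : (0 : ℝ) < (P n).card := by exact_mod_cast (hne n).card_pos
  have h1 : ((P n).filter (· ∈ g • W)).card ≤ ((P (n + 1)).filter (· ∈ W)).card := by
    refine Finset.card_le_card_of_injOn (fun y => g⁻¹ * y) ?_ (fun _ _ _ _ h => mul_left_cancel h)
    intro y hy
    simp only [Finset.coe_filter, Set.mem_ofPred_eq, hmem, Set.mem_smul_set_iff_inv_smul_mem,
      smul_eq_mul] at hy ⊢
    refine ⟨⟨?_, hW hy.2⟩, hy.2⟩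
    rw [mul_left_comm]
    exact inv_mul_mem_cube hg hy.1.1
  have h2 : ((P (n + 1)).filter (· ∈ W)).card ≤
      ((P n).filter (· ∈ W)).card + (P (n + 1) \ P n).card := by
    refine (Finset.card_le_card ?_).trans (Finset.card_union_le _ _)
    intro y hy
    simp only [Finset.mem_filter, Finset.mem_union, Finset.mem_sdiff] at hy ⊢
    tauto
  have h3 := Finset.card_sdiff_add_card_eq_card (hmono n)
  have h1' : (((P n).filter (· ∈ g • W)).card : ℝ) ≤ ((P (n + 1)).filter (· ∈ W)).card := by
    exact_mod_cast h1
  have h2' : (((P (n + 1)).filter (· ∈ W)).card : ℝ) ≤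
      ((P n).filter (· ∈ W)).card + (P (n + 1) \ P n).card := by exact_mod_cast h2
  have h3' : ((P (n + 1) \ P n).card : ℝ) + (P n).card = (P (n + 1)).card := by exact_mod_cast h3
  unfold density
  rw [div_add' _ _ _ hpos.ne']
  gcongr
  linarith

end Growth

/-! ### Invariant means as limits of counting measures. -/

/-- A finitely additive content on the subsets of `G`, normalized on `X` and invariant under
translations of subsets of `X`, which is a limit of counting measures. -/
structure IsMean {G : Type*} [CommGroup G] (X : Set G) (μ : Set G → ℝ) : Prop where
  nonneg : ∀ W, 0 ≤ μ W
  self : μ X = 1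
  mono : ∀ {V W}, V ⊆ W → μ V ≤ μ W
  union_le : ∀ V W, μ (V ∪ W) ≤ μ V + μ W
  smul_le : ∀ (g : G) {W}, W ⊆ X → μ (g • W) ≤ μ W
  approx : ∀ (𝒲 : Set (Set G)), 𝒲.Finite → ∀ {ε : ℝ}, 0 < ε →
    ∃ P : Finset G, P.Nonempty ∧ ∀ W ∈ 𝒲, μ W - ε < density P W

/-- The index `(S, m)` asks for almost invariance under `S` up to `1 / (m + 1)`. Along an
ultrafilter finer than `atTop` all densities converge, every `g` eventually lies in `S`, and the
error disappears. -/
theorem exists_isMean {G : Type*} [CommGroup G] {X : Set G} (hX : X.Nonempty) :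
    ∃ μ, IsMean X μ := by
  classical
  choose P hne hsub hinv using fun i : Finset G × ℕ =>
    exists_almost_invariant i.1 hX (δ := 1 / ((i.2 : ℝ) + 1)) (by positivity)
  let F : Ultrafilter (Finset G × ℕ) := Ultrafilter.of Filter.atTop
  have hF : (F : Filter (Finset G × ℕ)) ≤ Filter.atTop := Ultrafilter.of_le _
  have hlim : ∀ W : Set G, ∃ a : ℝ, Filter.Tendsto (fun i => density (P i) W) F (nhds a) := by
    intro W
    obtain ⟨a, -, ha⟩ := (isCompact_Icc (a := (0 : ℝ)) (b := 1)).ultrafilter_le_nhds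
      (F.map fun i => density (P i) W) (by
        rw [Filter.le_principal_iff]
        exact Filter.Eventually.of_forall (f := (F : Filter (Finset G × ℕ)))
          (p := fun i => density (P i) W ∈ Set.Icc (0 : ℝ) 1)
          fun i => ⟨density_nonneg _ _, density_le_one _ _⟩)
    exact ⟨a, ha⟩
  choose μ hμ using hlim
  refine ⟨μ, ?_, ?_, ?_, ?_, ?_, ?_⟩
  · exact fun W => ge_of_tendsto' (hμ W) fun i => density_nonneg _ _
  · refine tendsto_nhds_unique (hμ X) ?_
    simp_rw [density_eq_one (hne _) (hsub _)]
    exact tendsto_const_nhds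
  · exact fun h => le_of_tendsto_of_tendsto' (hμ _) (hμ _) fun i => density_mono _ h
  · exact fun V W => le_of_tendsto_of_tendsto' (hμ _) ((hμ V).add (hμ W))
      fun i => density_union_le _ _ _
  · intro g W hW
    have ht : Filter.Tendsto (fun i : Finset G × ℕ => 1 / ((i.2 : ℝ) + 1)) F (nhds 0) := by
      have h2 : Filter.Tendsto (fun i : Finset G × ℕ => i.2) F Filter.atTop :=
        (Filter.prod_atTop_atTop_eq (α := Finset G) (β := ℕ) ▸ Filter.tendsto_snd).mono_left hF
      exact tendsto_one_div_add_atTop_nhds_zero_nat.comp h2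
    have h1 : ∀ᶠ i in (F : Filter (Finset G × ℕ)), g ∈ i.1 := by
      refine hF ?_
      filter_upwards [Filter.eventually_ge_atTop (({g}, 0) : Finset G × ℕ)] with i hi
      exact hi.1 (Finset.mem_singleton_self g)
    have := le_of_tendsto_of_tendsto (hμ (g • W)) ((hμ W).add ht)
      (h1.mono fun i hi => hinv i g hi W hW)
    simpa using this
  · intro 𝒲 hfin ε hε
    have : ∀ᶠ i in (F : Filter (Finset G × ℕ)), ∀ W ∈ 𝒲, μ W - ε < density (P i) W :=
      (Filter.eventually_all_finite hfin).2 fun W _ => (hμ W).eventually (lt_mem_nhds (by linarith))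
    obtain ⟨i, hi⟩ := this.exists
    exact ⟨P i, hne i, hi⟩

/-! ### Bounded shattering dimension and separability for a mean. -/

/-- The family `𝒢` shatters no set of `D` points. -/
def NotShatter {G : Type*} (𝒢 : Set (Set G)) (D : ℕ) : Prop :=
  ¬ ∃ (a : Fin D → G) (b : Set (Fin D) → Set G), (∀ S, b S ∈ 𝒢) ∧ ∀ i S, a i ∈ b S ↔ i ∈ S

theorem NotShatter.mono {G : Type*} {𝒢 ℋ : Set (Set G)} {D : ℕ} (h : NotShatter ℋ D)
    (hs : 𝒢 ⊆ ℋ) : NotShatter 𝒢 D :=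
  fun ⟨a, b, hb, hab⟩ => h ⟨a, b, fun S => hs (hb S), hab⟩

theorem sum_choose_le (s D : ℕ) : ∑ k ∈ Finset.range D, s.choose k ≤ (s + 1) ^ D := by
  induction D with
  | zero => simp
  | succ D ih =>
    rw [Finset.sum_range_succ, pow_succ]
    have h1 : s.choose D ≤ (s + 1) ^ D :=
      (Nat.choose_le_pow s D).trans (Nat.pow_le_pow_left (Nat.le_succ s) D)
    rcases Nat.eq_zero_or_pos s with rfl | hs
    · rcases D with _ | D
      · simp
      · simpa using ih
    · nlinarith [Nat.one_le_pow D (s + 1) (by omega)]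

/-- Sauer–Shelah: by `hx` the traces of the `Y i` on the sample `x` are distinct, and they form a
family on `s` points shattering no set of size `D`. -/
theorem card_le_of_notShatter {G : Type*} {𝒢 : Set (Set G)} {D N s : ℕ} (h : NotShatter 𝒢 D)
    {Y : Fin N → Set G} (hY : ∀ i, Y i ∈ 𝒢) {x : Fin s → G}
    (hx : ∀ i j, i ≠ j → ∃ t, x t ∈ symmDiff (Y i) (Y j)) : N ≤ (s + 1) ^ D := by
  classical
  let T : Fin N → Finset (Fin s) := fun i => Finset.univ.filter fun t => x t ∈ Y i
  have hT : ∀ i t, t ∈ T i ↔ x t ∈ Y i := by simp [T]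
  have hinj : Function.Injective T := by
    intro i j hij
    by_contra hne
    obtain ⟨t, ht⟩ := hx i j hne
    have := hT i t
    rw [hij, hT] at this
    rcases ht with ⟨h1, h2⟩ | ⟨h1, h2⟩ <;> tauto
  let 𝒜 : Finset (Finset (Fin s)) := Finset.univ.image T
  have hcard : 𝒜.card = N := by
    rw [Finset.card_image_of_injective _ hinj, Finset.card_univ, Fintype.card_fin]
  have hvc : ∀ t : Finset (Fin s), 𝒜.Shatters t → t.card < D := by
    intro t ht
    by_contra! hD
    obtain ⟨t', ht', hcard'⟩ := Finset.exists_subset_card_eq hD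
    have hsh := Finset.Shatters.mono_right ht' ht
    let e := t'.equivFinOfCardEq hcard'
    have hb : ∀ S : Set (Fin D), ∃ i : Fin N, ∀ k : Fin D, x (e.symm k) ∈ Y i ↔ k ∈ S := by
      intro S
      obtain ⟨A, hA, hAt⟩ := hsh (t := t'.filter fun y => ∃ hy : y ∈ t', e ⟨y, hy⟩ ∈ S)
        (Finset.filter_subset _ _)
      obtain ⟨i, -, rfl⟩ := Finset.mem_image.1 hA
      refine ⟨i, fun k => ?_⟩
      have := congrArg (fun B => (e.symm k : Fin s) ∈ B) hAt
      simp only [Finset.mem_inter, hT, Finset.mem_filter, Finset.coe_mem, true_and, eq_iff_iff,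
        Subtype.coe_eta, Equiv.apply_symm_apply, exists_prop] at this
      exact this
    choose b hb using hb
    exact h ⟨fun k => x (e.symm k), fun S => Y (b S), fun S => hY _, fun i S => hb S i⟩
  calc N = 𝒜.card := hcard.symm
    _ ≤ 𝒜.shatterer.card := Finset.card_le_card_shatterer 𝒜
    _ ≤ ∑ k ∈ Finset.range D, s.choose k := by
      have : 𝒜.shatterer ⊆ (Finset.range D).biUnion fun k => Finset.univ.powersetCard k := by
        intro t ht
        simp only [Finset.mem_biUnion, Finset.mem_range, Finset.mem_powersetCard, Finset.subset_univ,
          true_and]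
        exact ⟨_, hvc t (Finset.mem_shatterer.1 ht), rfl⟩
      refine (Finset.card_le_card this).trans (Finset.card_biUnion_le.trans ?_)
      simp
    _ ≤ _ := sum_choose_le s D

/-- Supplies the union bound over all pairs from `(s + 1) ^ D + 1` sets, one more than Sauer–Shelah
allows on `s` points. -/
theorem exists_sample_size (D : ℕ) {ε : ℝ} (h0 : 0 < ε) (h1 : ε ≤ 1) :
    ∃ s : ℕ, (((s : ℝ) + 1) ^ D + 1) ^ 2 * (1 - ε) ^ s < 1 := by
  have ht := tendsto_pow_const_mul_const_pow_of_lt_one (2 * D) (show 0 ≤ 1 - ε by linarith)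
    (show 1 - ε < 1 by linarith)
  have h2 : ∀ᶠ n : ℕ in Filter.atTop, (n : ℝ) ^ (2 * D) * (1 - ε) ^ n < 1 / (2 ^ D + 1) ^ 2 :=
    ht.eventually (gt_mem_nhds (by positivity))
  obtain ⟨n, hn, hn1⟩ := (h2.and (Filter.eventually_ge_atTop 1)).exists
  refine ⟨n, ?_⟩
  have hn1' : (1 : ℝ) ≤ n := by exact_mod_cast hn1
  rw [lt_div_iff₀ (by positivity)] at hn
  refine lt_of_le_of_lt ?_ hn
  have h3 : ((n : ℝ) + 1) ^ D + 1 ≤ n ^ D * (2 ^ D + 1) := by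
    have h4 : ((n : ℝ) + 1) ^ D ≤ (n * 2) ^ D := by gcongr; linarith
    rw [mul_pow] at h4
    have : (1 : ℝ) ≤ n ^ D := one_le_pow₀ hn1'
    linarith
  have h5 : 0 ≤ (1 - ε) ^ n := pow_nonneg (by linarith) _
  calc (((n : ℝ) + 1) ^ D + 1) ^ 2 * (1 - ε) ^ n ≤ (n ^ D * (2 ^ D + 1)) ^ 2 * (1 - ε) ^ n := by
        gcongr
    _ = _ := by ring

/-- A family of subsets of bounded shattering dimension that are far apart with respect to a
counting measure is small. -/
theorem exists_density_symmDiff_lt (D : ℕ) {ε : ℝ} (hε : 0 < ε) :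
    ∃ N : ℕ, ∀ {G : Type u} {𝒢 : Set (Set G)}, NotShatter 𝒢 D → ∀ {P : Finset G}, P.Nonempty →
      ∀ Y : Fin N → Set G, (∀ i, Y i ∈ 𝒢) → ∃ i j, i < j ∧ density P (symmDiff (Y i) (Y j)) < ε := by
  classical
  wlog hε1 : ε ≤ 1 generalizing ε
  · obtain ⟨N, hN⟩ := this one_pos le_rfl
    refine ⟨N, fun h P hP Y hY => ?_⟩
    obtain ⟨i, j, hij, h⟩ := hN h hP Y hY
    exact ⟨i, j, hij, by linarith⟩
  obtain ⟨s, hs⟩ := exists_sample_size D hε hε1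
  obtain ⟨N, hN⟩ : ∃ N, N = (s + 1) ^ D + 1 := ⟨_, rfl⟩
  refine ⟨N, fun {G} 𝒢 h P hP Y hY => ?_⟩
  by_contra! H
  have hPpos : (0 : ℝ) < P.card := by exact_mod_cast hP.card_pos
  -- Samples of `s` points that miss the difference of the pair. If all pairs are `ε`-separated, the
  -- bad samples for all pairs do not exhaust `P ^ s`; a sample outside them distinguishes all `N`
  -- sets, too many for Sauer–Shelah.
  let bad : Fin N × Fin N → Finset (Fin s → G) := fun p =>
    Fintype.piFinset fun _ => P.filter fun y => y ∉ symmDiff (Y p.1) (Y p.2)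
  have hbad : ∀ p : Fin N × Fin N, p.1 ≠ p.2 →
      ((bad p).card : ℝ) ≤ ((1 - ε) * P.card) ^ s := by
    intro p hp
    have hd : ε ≤ density P (symmDiff (Y p.1) (Y p.2)) := by
      rcases lt_or_gt_of_ne hp with h | h
      · exact H _ _ h
      · rw [symmDiff_comm]; exact H _ _ h
    unfold density at hd
    rw [le_div_iff₀ hPpos] at hd
    have := Finset.card_filter_add_card_filter_not (s := P) (fun y => y ∈ symmDiff (Y p.1) (Y p.2))
    have h' : (((P.filter (· ∈ symmDiff (Y p.1) (Y p.2))).card : ℝ)) +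
      (P.filter fun y => y ∉ symmDiff (Y p.1) (Y p.2)).card = P.card := by exact_mod_cast this
    simp only [bad, Fintype.card_piFinset, Finset.prod_const, Finset.card_univ, Fintype.card_fin]
    push_cast
    gcongr
    linarith
  let B := (Finset.univ.filter fun p : Fin N × Fin N => p.1 ≠ p.2).biUnion bad
  have hB : (B.card : ℝ) < (P.card : ℝ) ^ s := by
    calc (B.card : ℝ) ≤ ∑ p ∈ Finset.univ.filter fun p : Fin N × Fin N => p.1 ≠ p.2,
          ((bad p).card : ℝ) := by exact_mod_cast Finset.card_biUnion_le
      _ ≤ ∑ p ∈ Finset.univ.filter fun p : Fin N × Fin N => p.1 ≠ p.2,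
          ((1 - ε) * P.card) ^ s :=
        Finset.sum_le_sum fun p hp => hbad p (Finset.mem_filter.1 hp).2
      _ ≤ ∑ p : Fin N × Fin N, ((1 - ε) * P.card) ^ s :=
        Finset.sum_le_sum_of_subset_of_nonneg (Finset.filter_subset _ _) fun _ _ _ =>
          pow_nonneg (mul_nonneg (by linarith) hPpos.le) _
      _ = ((((s : ℝ) + 1) ^ D + 1) ^ 2 * (1 - ε) ^ s) * (P.card : ℝ) ^ s := by
        simp only [Finset.sum_const, Finset.card_univ, Fintype.card_prod, Fintype.card_fin,
          nsmul_eq_mul, hN]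
        push_cast
        rw [mul_pow]
        ring
      _ < 1 * (P.card : ℝ) ^ s := by gcongr
      _ = _ := one_mul _
  have hcardlt : B.card < (Fintype.piFinset fun _ : Fin s => P).card := by
    rw [Fintype.card_piFinset]
    simp only [Finset.prod_const, Finset.card_univ, Fintype.card_fin]
    exact_mod_cast hB
  obtain ⟨x, hxP, hxB⟩ := Finset.exists_mem_notMem_of_card_lt_card hcardlt
  have := card_le_of_notShatter h hY (x := x) (by
    intro i j hij
    by_contra! hno
    refine hxB (Finset.mem_biUnion.2 ⟨(i, j), by simpa using hij, ?_⟩)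
    simp only [bad, Fintype.mem_piFinset, Finset.mem_filter] at hxP ⊢
    exact fun t => ⟨hxP t, hno t⟩)
  omega

/-- Without a net, a greedy choice gives an infinite `ε`-separated sequence. Its first `N` terms
remain `ε / 2`-separated for a counting measure approximating `μ`. -/
theorem IsMean.exists_finite_net {G : Type u} [CommGroup G] {X : Set G} {μ : Set G → ℝ}
    (hμ : IsMean X μ) {𝒢 : Set (Set G)} {D : ℕ} (h : NotShatter 𝒢 D) {ε : ℝ} (hε : 0 < ε) :
    ∃ F : Set (Set G), F.Finite ∧ F ⊆ 𝒢 ∧ ∀ Y ∈ 𝒢, ∃ Z ∈ F, μ (symmDiff Z Y) < ε := by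
  by_contra! H
  obtain ⟨f, hf, hsep⟩ := exists_seq_of_forall_finset_exists (fun Y => Y ∈ 𝒢)
    (fun Z Y => ε ≤ μ (symmDiff Z Y)) (fun s hs => H s s.finite_toSet hs)
  obtain ⟨N, hN⟩ := exists_density_symmDiff_lt.{u} D (half_pos hε)
  obtain ⟨P, hP, happ⟩ := hμ.approx
    (Set.range fun p : Fin N × Fin N => symmDiff (f p.1) (f p.2)) (Set.finite_range _) (half_pos hε)
  obtain ⟨i, j, hij, hlt⟩ := hN h hP (fun i => f i) (fun i => hf i)
  have h1 := happ _ ⟨(i, j), rfl⟩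
  have h2 := hsep i j hij
  simp only at h1
  linarith

/-- A family of bounded shattering dimension is separable with respect to a mean. -/
theorem IsMean.exists_dense_seq {G : Type u} [CommGroup G] {X : Set G} {μ : Set G → ℝ}
    (hμ : IsMean X μ) {𝒢 : Set (Set G)} {D : ℕ} (h : NotShatter 𝒢 D) :
    ∃ d : ℕ → Set G, ∀ Y ∈ 𝒢, ∀ ε > 0, ∃ i, d i ∈ 𝒢 ∧ μ (symmDiff (d i) Y) < ε := by
  choose F hfin hsub hF using fun j : ℕ =>
    hμ.exists_finite_net h (ε := 1 / ((j : ℝ) + 1)) (by positivity)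
  rcases 𝒢.eq_empty_or_nonempty with rfl | ⟨Y₀, hY₀⟩
  · exact ⟨fun _ => ∅, by simp⟩
  have hc : (⋃ j, F j).Countable := Set.countable_iUnion fun j => (hfin j).countable
  obtain ⟨Z₀, hZ₀, -⟩ := hF 0 Y₀ hY₀
  obtain ⟨d, hd⟩ := hc.exists_eq_range ⟨Z₀, Set.mem_iUnion.2 ⟨0, hZ₀⟩⟩
  refine ⟨d, fun Y hY ε hε => ?_⟩
  obtain ⟨j, hj⟩ := exists_nat_one_div_lt hε
  obtain ⟨Z, hZ, hlt⟩ := hF j Y hY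
  have : Z ∈ Set.range d := hd ▸ Set.mem_iUnion.2 ⟨j, hZ⟩
  obtain ⟨i, rfl⟩ := this
  exact ⟨i, hsub j hZ, hlt.trans hj⟩

/-- Members of a family of bounded shattering dimension are determined by countable data up to
sets of measure zero. -/
theorem IsMean.exists_code {G : Type u} [CommGroup G] {X : Set G} {μ : Set G → ℝ}
    (hμ : IsMean X μ) {𝒢 : Set (Set G)} {D : ℕ} (h : NotShatter 𝒢 D) :
    ∃ code : Set G → Set (ℕ × ℕ), ∀ Y ∈ 𝒢, ∀ Z ∈ 𝒢, code Y = code Z → μ (symmDiff Y Z) ≤ 0 := by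
  obtain ⟨d, hd⟩ := hμ.exists_dense_seq h
  refine ⟨fun Y => {q | μ (symmDiff (d q.1) Y) < 1 / ((q.2 : ℝ) + 1)}, fun Y hY Z _ hYZ => ?_⟩
  refine le_of_forall_pos_le_add fun ε hε => ?_
  obtain ⟨j, hj⟩ := exists_nat_one_div_lt (half_pos hε)
  obtain ⟨i, -, hi⟩ := hd Y hY (1 / ((j : ℝ) + 1)) (by positivity)
  have hi' : μ (symmDiff (d i) Z) < 1 / ((j : ℝ) + 1) := (Set.ext_iff.1 hYZ (i, j)).1 hi
  have hsub : symmDiff Y Z ⊆ symmDiff (d i) Y ∪ symmDiff (d i) Z := by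
    intro x
    simp only [Set.mem_symmDiff, Set.mem_union]
    tauto
  linarith [(hμ.mono hsub).trans (hμ.union_le _ _)]

/-- Elements `g` are determined by countable data up to the action on a family of bounded
shattering dimension, modulo sets of measure zero. -/
theorem IsMean.exists_smul_code {G : Type u} [CommGroup G] {X : Set G} {μ : Set G → ℝ}
    (hμ : IsMean X μ) {V : Set G} {ℱ : Set (Set G)} {D : ℕ} (hX : ∀ Y ∈ ℱ, Y ⊆ X)
    (h1 : (1 : G) ∈ V) (h : NotShatter {S | ∃ g ∈ V, ∃ Y ∈ ℱ, S = g • Y} D) :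
    ∃ code : G → Set (ℕ × ℕ × ℕ), ∀ g ∈ V, ∀ g' ∈ V, code g = code g' →
      ∀ Y ∈ ℱ, μ (symmDiff (g • Y) (g' • Y)) ≤ 0 := by
  obtain ⟨d, hd⟩ := hμ.exists_dense_seq h
  -- Since `1 ∈ V`, the family `ℱ` is part of the family of translates and inherits its shattering
  -- bound.
  obtain ⟨e, he⟩ := hμ.exists_dense_seq (h.mono (𝒢 := ℱ) fun Y hY => ⟨1, h1, Y, hY, by simp⟩)
  refine ⟨fun g => {q | μ (symmDiff (d q.1) (g • e q.2.2)) < 1 / ((q.2.1 : ℝ) + 1)},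
    fun g hg g' _ hgg Y hY => ?_⟩
  refine le_of_forall_pos_le_add fun ε hε => ?_
  obtain ⟨j, hj⟩ := exists_nat_one_div_lt (show 0 < ε / 4 by positivity)
  obtain ⟨k, hk, hkY⟩ := he Y hY (ε / 4) (by positivity)
  obtain ⟨i, -, hi⟩ := hd (g • e k) ⟨g, hg, _, hk, rfl⟩ (1 / ((j : ℝ) + 1)) (by positivity)
  have hi' : μ (symmDiff (d i) (g' • e k)) < 1 / ((j : ℝ) + 1) :=
    (Set.ext_iff.1 hgg (i, j, k)).1 hi
  -- Triangle inequality along `g • Y`, `g • e k`, `d i`, `g' • e k`, `g' • Y`; each of the four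
  -- distances is below `ε / 4`.
  have hsub : symmDiff (g • Y) (g' • Y) ⊆ (g • symmDiff (e k) Y ∪ g' • symmDiff (e k) Y) ∪
      (symmDiff (d i) (g • e k) ∪ symmDiff (d i) (g' • e k)) := by
    intro x
    simp only [Set.mem_symmDiff, Set.mem_union, Set.mem_smul_set_iff_inv_smul_mem]
    tauto
  have hX' : symmDiff (e k) Y ⊆ X := by
    intro x hx
    rcases hx with hx | hx
    · exact hX _ hk hx.1
    · exact hX _ hY hx.1
  have h2 := (hμ.mono hsub).trans (hμ.union_le _ _)
  have h3 := hμ.union_le (g • symmDiff (e k) Y) (g' • symmDiff (e k) Y)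
  have h4 := hμ.union_le (symmDiff (d i) (g • e k)) (symmDiff (d i) (g' • e k))
  linarith [hμ.smul_le g hX', hμ.smul_le g' hX']

/-- If `μ W ≤ 0`, finite subadditivity and `smul_le` would give `μ X ≤ 0`. -/
theorem IsMean.pos_of_cover {G : Type u} [CommGroup G] {X : Set G} {μ : Set G → ℝ}
    (hμ : IsMean X μ) {W : Set G} (hW : W ⊆ X) {ι : Type*} [Finite ι] {g : ι → G}
    (h : X ⊆ ⋃ i, g i • W) : 0 < μ W := by
  classical
  cases nonempty_fintype ι
  by_contra! h0
  have key : ∀ s : Finset ι, μ (⋃ i ∈ s, g i • W) ≤ 0 := by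
    intro s
    induction s using Finset.induction_on with
    | empty => exact (hμ.mono (by simp)).trans h0
    | insert i s _ ih =>
      rw [Finset.set_biUnion_insert]
      linarith [hμ.union_le (g i • W) (⋃ i ∈ s, g i • W), hμ.smul_le (g i) hW]
  have := (hμ.mono h).trans (by simpa using key Finset.univ)
  rw [hμ.self] at this
  linarith

/-! ### Compactness, and formulas with parameters. -/

section Saturation

variable {L : FirstOrder.Language.{u, v}} {M : Type w} [L.Structure M] {κ : Cardinal.{w}}

/-- Each definable set needs only finitely many parameters, so fewer than `κ` parameters suffice for
the whole family and saturation applies. -/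
theorem IsSaturated.nonempty_iInter (hsat : IsSaturated L M κ) (hκ : ℵ₀ < κ) {α : Type} [Finite α]
    {ι : Type w} (hι : #ι < κ) {C : ι → Set (α → M)} (hC : ∀ i, IsDefinable L (C i))
    (hfip : ∀ s : Finset ι, (⋂ i ∈ s, C i).Nonempty) : (⋂ i, C i).Nonempty := by
  classical
  choose A₀ _ hA using fun i => Set.definable_iff_finitely_definable.1 (hC i)
  let A : Set M := ⋃ i, (A₀ i : Set M)
  have hAcard : #A < κ := by
    refine (Cardinal.mk_iUnion_le _).trans_lt (Cardinal.mul_lt_of_lt hκ.le hι ?_)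
    exact (ciSup_le' fun i => (Cardinal.lt_aleph0_of_finite _).le).trans_lt hκ
  have hdef : ∀ i, A.Definable L (C i) := fun i =>
    (hA i).mono (Set.subset_iUnion (fun i => (A₀ i : Set M)) i)
  choose φ hφ using hdef
  obtain ⟨m, ⟨e⟩⟩ := Finite.exists_equiv_fin α
  obtain ⟨x, hx⟩ := hsat A hAcard m (Set.range fun i => (φ i).relabel e) (by
    intro q hq
    obtain ⟨s, rfl⟩ : ∃ s : Finset ι, s.image (fun i => (φ i).relabel e) = q := by
      obtain ⟨s, -, hs⟩ := Finset.subset_set_image_iff.1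
        (show (q : Set (L[[A]].Formula (Fin m))) ⊆ (fun i => (φ i).relabel e) '' Set.univ by
          rwa [Set.image_univ])
      exact ⟨s, hs⟩
    obtain ⟨y, hy⟩ := hfip s
    refine ⟨y ∘ e.symm, fun ψ hψ => ?_⟩
    obtain ⟨i, hi, rfl⟩ := Finset.mem_image.1 hψ
    have := Set.mem_iInter₂.1 hy i hi
    rw [hφ i] at this
    rw [Language.Formula.realize_relabel, Function.comp_assoc, Equiv.symm_comp_self,
      Function.comp_id]
    exact this)
  refine ⟨x ∘ e, Set.mem_iInter.2 fun i => ?_⟩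
  rw [hφ i]
  exact Language.Formula.realize_relabel.1 (hx _ ⟨i, rfl⟩)

theorem IsSaturated.exists_finset_cover (hsat : IsSaturated L M κ) (hκ : ℵ₀ < κ) {α : Type}
    [Finite α] {ι : Type w} (hι : #ι < κ) {C : ι → Set (α → M)} (hC : ∀ i, IsDefinable L (C i))
    {Y : Set (α → M)} (hY : IsDefinable L Y) (h : Y ⊆ ⋃ i, C i) :
    ∃ s : Finset ι, Y ⊆ ⋃ i ∈ s, C i := by
  rcases isEmpty_or_nonempty ι with hι' | hι'
  · exact ⟨∅, by simpa using h⟩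
  by_contra! H
  obtain ⟨x, hx⟩ := hsat.nonempty_iInter hκ hι (C := fun i => Y \ C i) (fun i => hY.sdiff (hC i)) (by
    intro s
    obtain ⟨x, hxY, hx⟩ := Set.not_subset.1 (H s)
    refine ⟨x, Set.mem_iInter₂.2 fun i hi => ⟨hxY, fun hxi => hx ?_⟩⟩
    exact Set.mem_iUnion₂.2 ⟨i, hi, hxi⟩)
  rw [Set.mem_iInter] at hx
  obtain ⟨i, hi⟩ := Set.mem_iUnion.1 (h (hx (Classical.arbitrary ι)).1)
  exact (hx i).2 hi

theorem IsSaturated.exists_finset_iInter_subset (hsat : IsSaturated L M κ) (hκ : ℵ₀ < κ)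
    {α : Type} [Finite α] {ι ι' : Type w} (hι : #ι < κ) (hι' : #ι' < κ) {D : ι → Set (α → M)}
    {C : ι' → Set (α → M)} (hD : ∀ i, IsDefinable L (D i)) (hC : ∀ i, IsDefinable L (C i))
    (h : ⋂ i, D i ⊆ ⋃ i, C i) :
    ∃ (s : Finset ι) (t : Finset ι'), ⋂ i ∈ s, D i ⊆ ⋃ i ∈ t, C i := by
  classical
  by_contra! H
  obtain ⟨x, hx⟩ := hsat.nonempty_iInter hκ (ι := ι ⊕ ι')
    (by
      rw [Cardinal.mk_sum, Cardinal.lift_id, Cardinal.lift_id]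
      exact Cardinal.add_lt_of_lt hκ.le hι hι')
    (C := Sum.elim D fun i => (C i)ᶜ)
    (by
      rintro (i | i)
      · exact hD i
      · exact (hC i).compl)
    (by
      intro s
      obtain ⟨x, hxD, hxC⟩ := Set.not_subset.1 (H s.toLeft s.toRight)
      refine ⟨x, Set.mem_iInter₂.2 ?_⟩
      rintro (i | i) hi
      · exact Set.mem_iInter₂.1 hxD i (Finset.mem_toLeft.2 hi)
      · exact fun hxi => hxC (Set.mem_iUnion₂.2 ⟨i, Finset.mem_toRight.2 hi, hxi⟩))
  rw [Set.mem_iInter] at hx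
  obtain ⟨i, hi⟩ := Set.mem_iUnion.1 (h (Set.mem_iInter.2 fun i => hx (Sum.inl i)))
  exact hx (Sum.inr i) hi

theorem isDefinable_singleton {α : Type} [Finite α] (a : α → M) : IsDefinable L {a} := by
  have : ({a} : Set (α → M)) = ⋂ i, (fun x : α → M => x ∘ fun _ : Fin 1 => i) ⁻¹'
      {x | x 0 ∈ ({a i} : Set M)} := by
    ext x
    simp [funext_iff]
  rw [this]
  exact Set.definable_iInter_of_finite fun i =>
    (Set.Definable.singleton_of_mem L (Set.mem_univ (a i))).preimage_comp _

theorem isDefinable_realize {α : Type} (φ : L.Formula α) :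
    IsDefinable L {x : α → M | φ.Realize x} :=
  Set.Definable.mono (A := ∅) (Set.empty_definable_iff.2 ⟨φ, rfl⟩) (Set.empty_subset _)

/-- Turning parameters into a tuple `c` leaves a formula without parameters; definable sets thus
fall into as few families as there are `L`-formulas. -/
theorem IsDefinable.exists_formula {n : ℕ} {X : Set (Fin n → M)} (hX : IsDefinable L X) :
    ∃ (k : ℕ) (φ : L.Formula (Fin k ⊕ Fin n)) (c : Fin k → M),
      X = {x | φ.Realize (Sum.elim c x)} := by
  obtain ⟨A, -, hA⟩ := Set.definable_iff_finitely_definable.1 hX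
  obtain ⟨φ, rfl⟩ := Set.definable_iff_exists_formula_sum.1 hA
  obtain ⟨k, ⟨e⟩⟩ := Finite.exists_equiv_fin (A : Set M)
  refine ⟨k, φ.relabel (Sum.map e id), fun i => e.symm i, ?_⟩
  ext x
  simp only [Set.mem_ofPred_eq, Language.Formula.realize_relabel]
  refine iff_of_eq (congrArg _ ?_)
  funext i
  rcases i with i | i <;> simp

/-- In an NIP structure also formulas with parameters have NIP. -/
theorem IsNIP.exists_not_shatter (h : IsNIP L M) {α β : Type} [Finite α] [Finite β]
    {R : Set (α ⊕ β → M)} (hR : IsDefinable L R) :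
    ∃ N : ℕ, ¬ ∃ (a : Fin N → α → M) (b : Set (Fin N) → β → M),
      ∀ (i : Fin N) (S : Set (Fin N)), Sum.elim (a i) (b S) ∈ R ↔ i ∈ S := by
  obtain ⟨A, -, hA⟩ := Set.definable_iff_finitely_definable.1 hR
  obtain ⟨φ, rfl⟩ := Set.definable_iff_exists_formula_sum.1 hA
  obtain ⟨m, ⟨e⟩⟩ := Finite.exists_equiv_fin α
  obtain ⟨k, ⟨f⟩⟩ := Finite.exists_equiv_fin ((A : Set M) ⊕ β)
  obtain ⟨N, hN⟩ := h m k (φ.relabel (Sum.elim (fun x => Sum.inr (f (Sum.inl x)))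
    (Sum.elim (fun x => Sum.inl (e x)) fun x => Sum.inr (f (Sum.inr x)))))
  refine ⟨N, fun ⟨a, b, hab⟩ => hN ⟨fun i => a i ∘ e.symm,
    fun S => Sum.elim (fun x : (A : Set M) => (x : M)) (b S) ∘ f.symm, fun i S => ?_⟩⟩
  rw [← hab i S, Language.Formula.realize_relabel, Set.mem_ofPred_eq]
  refine iff_of_eq (congrArg _ ?_)
  funext x
  rcases x with x | x | x <;> simp

theorem card_formula_le (L : FirstOrder.Language.{u, v}) (n : ℕ) :
    #(Σ k : ℕ, L.Formula (Fin k ⊕ Fin n)) ≤ max ℵ₀ L.card := by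
  have h : ∀ k : ℕ, #(L.Formula (Fin k ⊕ Fin n)) ≤ max ℵ₀ L.card := by
    intro k
    have h1 : #(L.Formula (Fin k ⊕ Fin n)) ≤ #(Σ m, L.BoundedFormula (Fin k ⊕ Fin n) m) :=
      Cardinal.mk_le_of_injective (f := fun φ => ⟨0, φ⟩) fun φ ψ h => by simpa using h
    refine h1.trans (Language.BoundedFormula.card_le.trans ?_)
    refine max_le (le_max_left _ _) ?_
    have h2 : Cardinal.lift.{max u v} #(Fin k ⊕ Fin n) ≤ ℵ₀ := by
      rw [Cardinal.lift_le_aleph0]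
      exact (Cardinal.lt_aleph0_of_finite _).le
    have h3 : Cardinal.lift.{0} L.card = L.card := Cardinal.lift_id' _
    rw [h3]
    refine (Cardinal.add_le_max _ _).trans ?_
    exact max_le (max_le (h2.trans (le_max_left _ _)) (le_max_right _ _)) (le_max_left _ _)
  rw [Cardinal.mk_sigma]
  refine (Cardinal.sum_le_sum _ (fun _ => max ℵ₀ L.card) h).trans ?_
  rw [Cardinal.sum_const]
  simp

end Saturation

/-! ### Definability of the group operations. -/

section GroupDefinability

variable {L : FirstOrder.Language.{u, v}} {M : Type w} [L.Structure M] {κ : Cardinal.{w}}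
variable {n : ℕ} {U : Set (Fin n → M)}

theorem IsDefinableIn.union {X Y : Set U} (hX : IsDefinableIn L X) (hY : IsDefinableIn L Y) :
    IsDefinableIn L (X ∪ Y) := by
  unfold IsDefinableIn
  rw [Set.image_union]
  exact Set.Definable.union hX hY

theorem IsDefinableIn.inter {X Y : Set U} (hX : IsDefinableIn L X) (hY : IsDefinableIn L Y) :
    IsDefinableIn L (X ∩ Y) := by
  unfold IsDefinableIn
  rw [Set.image_inter Subtype.val_injective]
  exact Set.Definable.inter hX hY

theorem IsDefinableIn.sdiff {X Y : Set U} (hX : IsDefinableIn L X) (hY : IsDefinableIn L Y) :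
    IsDefinableIn L (X \ Y) := by
  unfold IsDefinableIn
  rw [Set.image_sdiff Subtype.val_injective]
  exact Set.Definable.sdiff hX hY

theorem IsDefinableIn.symmDiff {X Y : Set U} (hX : IsDefinableIn L X) (hY : IsDefinableIn L Y) :
    IsDefinableIn L (symmDiff X Y) :=
  (hX.sdiff hY).union (hY.sdiff hX)

theorem isDefinableIn_singleton (g : U) : IsDefinableIn L {g} := by
  unfold IsDefinableIn
  rw [Set.image_singleton]
  exact isDefinable_singleton _

/-- The trace on `U` of a definable subset of `M ^ n`. -/
theorem IsDefinableIn.inter_preimage {X : Set U} (hX : IsDefinableIn L X) {D : Set (Fin n → M)}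
    (hD : IsDefinable L D) : IsDefinableIn L (X ∩ {g : U | (g : Fin n → M) ∈ D}) := by
  have : (fun g : U => (g : Fin n → M)) '' (X ∩ {g : U | (g : Fin n → M) ∈ D}) =
      (fun g : U => (g : Fin n → M)) '' X ∩ D := by
    ext x
    constructor
    · rintro ⟨g, ⟨hg, hgD⟩, rfl⟩
      exact ⟨⟨g, hg, rfl⟩, hgD⟩
    · rintro ⟨⟨g, hg, rfl⟩, hgD⟩
      exact ⟨g, ⟨hg, hgD⟩, rfl⟩
  unfold IsDefinableIn
  rw [this]
  exact Set.Definable.inter hX hD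

/-- The graph of the multiplication `Y × Z → U`. -/
def mulGraph [Group U] (Y Z : Set U) : Set (Fin n ⊕ Fin n ⊕ Fin n → M) :=
  {z | ∃ a b : U, a ∈ Y ∧ b ∈ Z ∧
    z = Sum.elim (a : Fin n → M) (Sum.elim (b : Fin n → M) ((a * b : U) : Fin n → M))}

theorem mem_mulGraph [Group U] {Y Z : Set U} {x y z : Fin n → M} :
    Sum.elim x (Sum.elim y z) ∈ mulGraph Y Z ↔
      ∃ a ∈ Y, ∃ b ∈ Z, (a : Fin n → M) = x ∧ (b : Fin n → M) = y ∧ ((a * b : U) : Fin n → M) = z := by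
  simp only [mulGraph, Set.mem_ofPred_eq, Sum.elim_eq_iff]
  constructor
  · rintro ⟨a, b, ha, hb, h1, h2, h3⟩
    exact ⟨a, ha, b, hb, h1.symm, h2.symm, h3.symm⟩
  · rintro ⟨a, ha, b, hb, h1, h2, h3⟩
    exact ⟨a, b, ha, hb, h1.symm, h2.symm, h3.symm⟩

variable (L κ U) in
/-- A `⋁`-definable group in a saturated structure. -/
structure IsSaturatedVDefinableGroup [Group U] : Prop where
  aleph0_lt : ℵ₀ < κ
  saturated : IsSaturated L M κ
  vDefinable : IsVDefinableGroup L κ U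

namespace IsSaturatedVDefinableGroup

variable [Group U]

theorem exists_cover (hU : IsSaturatedVDefinableGroup L κ U) :
    ∃ (ι : Type w) (X : ι → Set U), #ι < κ ∧ (∀ i, IsDefinableIn L (X i)) ∧
      Directed (· ⊆ ·) X ∧ (⋃ i, X i) = Set.univ ∧ ∀ i j, IsDefinable L (mulGraph (X i) (X j)) := by
  obtain ⟨ι, X, hι, hX, hdir, hUX, hmul⟩ := hU.vDefinable
  have himg : ∀ i, (fun g : U => (g : Fin n → M)) '' {g : U | (g : Fin n → M) ∈ X i} = X i := by
    intro i
    ext x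
    constructor
    · rintro ⟨g, hg, rfl⟩
      exact hg
    · intro hx
      exact ⟨⟨x, hUX ▸ Set.mem_iUnion.2 ⟨i, hx⟩⟩, hx, rfl⟩
  refine ⟨ι, fun i => {g : U | (g : Fin n → M) ∈ X i}, hι, fun i => ?_, fun i j => ?_, ?_, hmul⟩
  · unfold IsDefinableIn
    rw [himg]
    exact hX i
  · obtain ⟨k, hik, hjk⟩ := hdir i j
    exact ⟨k, fun g hg => hik hg, fun g hg => hjk hg⟩
  · refine Set.eq_univ_of_forall fun g => ?_
    have : (g : Fin n → M) ∈ ⋃ i, X i := hUX ▸ g.2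
    simpa using this

theorem exists_finset_cover (hU : IsSaturatedVDefinableGroup L κ U) {ι : Type w} (hι : #ι < κ)
    {C : ι → Set U} (hC : ∀ i, IsDefinableIn L (C i)) {Y : Set U} (hY : IsDefinableIn L Y)
    (h : Y ⊆ ⋃ i, C i) : ∃ s : Finset ι, Y ⊆ ⋃ i ∈ s, C i := by
  obtain ⟨s, hs⟩ := hU.saturated.exists_finset_cover hU.aleph0_lt hι hC hY (by
    rw [← Set.image_iUnion]
    exact Set.image_mono h)
  refine ⟨s, ?_⟩
  rw [← Set.image_iUnion₂] at hs
  exact (Set.image_subset_image_iff Subtype.val_injective).1 hs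

theorem exists_subset_of_directed (hU : IsSaturatedVDefinableGroup L κ U) {ι : Type w}
    (hι : #ι < κ) {C : ι → Set U} (hC : ∀ i, IsDefinableIn L (C i)) (hdir : Directed (· ⊆ ·) C)
    {Y : Set U} (hY : IsDefinableIn L Y) (h : Y ⊆ ⋃ i, C i) (hne : Nonempty ι) : ∃ i, Y ⊆ C i := by
  obtain ⟨s, hs⟩ := hU.exists_finset_cover hι hC hY h
  obtain ⟨i, hi⟩ := hdir.finset_le s
  exact ⟨i, hs.trans (Set.iUnion₂_subset hi)⟩

theorem definable_mulGraph (hU : IsSaturatedVDefinableGroup L κ U) {Y Z : Set U}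
    (hY : IsDefinableIn L Y) (hZ : IsDefinableIn L Z) : IsDefinable L (mulGraph Y Z) := by
  obtain ⟨ι, X, hι, hX, hdir, hcov, hmul⟩ := hU.exists_cover
  have hne : Nonempty ι := by
    obtain ⟨i, -⟩ := Set.mem_iUnion.1 (hcov ▸ Set.mem_univ (1 : U))
    exact ⟨i⟩
  obtain ⟨i, hi⟩ := hU.exists_subset_of_directed hι hX hdir hY (by simp [hcov]) hne
  obtain ⟨j, hj⟩ := hU.exists_subset_of_directed hι hX hdir hZ (by simp [hcov]) hne
  have : mulGraph Y Z = mulGraph (X i) (X j) ∩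
      ((fun z => z ∘ Sum.inl) ⁻¹' ((fun g : U => (g : Fin n → M)) '' Y) ∩
        (fun z => z ∘ (Sum.inr ∘ Sum.inl)) ⁻¹' ((fun g : U => (g : Fin n → M)) '' Z)) := by
    ext z
    constructor
    · rintro ⟨a, b, ha, hb, rfl⟩
      exact ⟨⟨a, b, hi ha, hj hb, rfl⟩, ⟨a, ha, rfl⟩, ⟨b, hb, rfl⟩⟩
    · rintro ⟨⟨a, b, -, -, rfl⟩, ⟨a', ha', h1⟩, ⟨b', hb', h2⟩⟩
      have h1' : a' = a := Subtype.ext h1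
      have h2' : b' = b := Subtype.ext h2
      subst h1' h2'
      exact ⟨a', b', ha', hb', rfl⟩
  rw [this]
  exact (hmul i j).inter ((Set.Definable.preimage_comp _ hY).inter (Set.Definable.preimage_comp _ hZ))

theorem mul (hU : IsSaturatedVDefinableGroup L κ U) {Y Z : Set U}
    (hY : IsDefinableIn L Y) (hZ : IsDefinableIn L Z) : IsDefinableIn L (Y * Z) := by
  have : (fun g : U => (g : Fin n → M)) '' (Y * Z) =
      (fun z : Fin n ⊕ Fin n ⊕ Fin n → M => z ∘ (Sum.inr ∘ Sum.inr)) '' mulGraph Y Z := by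
    ext x
    constructor
    · rintro ⟨_, ⟨a, ha, b, hb, rfl⟩, rfl⟩
      exact ⟨_, ⟨a, b, ha, hb, rfl⟩, rfl⟩
    · rintro ⟨_, ⟨a, b, ha, hb, rfl⟩, rfl⟩
      exact ⟨_, ⟨a, ha, b, hb, rfl⟩, rfl⟩
  unfold IsDefinableIn
  rw [this]
  exact (hU.definable_mulGraph hY hZ).image_comp _

theorem smul (hU : IsSaturatedVDefinableGroup L κ U) (g : U) {Y : Set U}
    (hY : IsDefinableIn L Y) : IsDefinableIn L (g • Y) := by
  rw [← Set.singleton_smul, smul_eq_mul]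
  exact hU.mul (isDefinableIn_singleton g) hY

theorem inv (hU : IsSaturatedVDefinableGroup L κ U) {Y : Set U} (hY : IsDefinableIn L Y) :
    IsDefinableIn L Y⁻¹ := by
  obtain ⟨ι, X, hι, hX, hdir, hcov, -⟩ := hU.exists_cover
  have hne : Nonempty ι := by
    obtain ⟨i, -⟩ := Set.mem_iUnion.1 (hcov ▸ Set.mem_univ (1 : U))
    exact ⟨i⟩
  have hdef : ∀ i, IsDefinable L (mulGraph Y (X i) ∩
      (fun z => z ∘ (Sum.inr ∘ Sum.inr)) ⁻¹' {((1 : U) : Fin n → M)}) := fun i =>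
    (hU.definable_mulGraph hY (hX i)).inter ((isDefinable_singleton _).preimage_comp _)
  have hleft : ∀ i, IsDefinableIn L {y | y ∈ Y ∧ y⁻¹ ∈ X i} := by
    intro i
    have : (fun g : U => (g : Fin n → M)) '' {y | y ∈ Y ∧ y⁻¹ ∈ X i} =
        (fun z : Fin n ⊕ Fin n ⊕ Fin n → M => z ∘ Sum.inl) '' (mulGraph Y (X i) ∩
          (fun z => z ∘ (Sum.inr ∘ Sum.inr)) ⁻¹' {((1 : U) : Fin n → M)}) := by
      ext x
      constructor
      · rintro ⟨y, ⟨hy, hy'⟩, rfl⟩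
        refine ⟨_, ⟨⟨y, y⁻¹, hy, hy', rfl⟩, ?_⟩, rfl⟩
        rw [mul_inv_cancel]
        rfl
      · rintro ⟨_, ⟨⟨a, b, ha, hb, rfl⟩, h⟩, rfl⟩
        have h' : a * b = 1 := Subtype.ext h
        refine ⟨a, ⟨ha, ?_⟩, rfl⟩
        rwa [inv_eq_of_mul_eq_one_right h']
    unfold IsDefinableIn
    rw [this]
    exact (hdef i).image_comp _
  -- Compactness bounds the inverses of elements of `Y` inside a single `X i`; the graph of
  -- inversion on `Y` can then be read off `mulGraph Y (X i)`.
  obtain ⟨i, hi⟩ := hU.exists_subset_of_directed hι hleft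
    (fun i j => by
      obtain ⟨k, hik, hjk⟩ := hdir i j
      exact ⟨k, fun y hy => ⟨hy.1, hik hy.2⟩, fun y hy => ⟨hy.1, hjk hy.2⟩⟩) hY
    (fun y hy => by
      obtain ⟨i, hi⟩ := Set.mem_iUnion.1 (hcov ▸ Set.mem_univ y⁻¹)
      exact Set.mem_iUnion.2 ⟨i, hy, hi⟩) hne
  have : (fun g : U => (g : Fin n → M)) '' Y⁻¹ =
      (fun z : Fin n ⊕ Fin n ⊕ Fin n → M => z ∘ (Sum.inr ∘ Sum.inl)) '' (mulGraph Y (X i) ∩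
        (fun z => z ∘ (Sum.inr ∘ Sum.inr)) ⁻¹' {((1 : U) : Fin n → M)}) := by
    ext x
    constructor
    · rintro ⟨y, hy, rfl⟩
      refine ⟨_, ⟨⟨y⁻¹, y, hy, ?_, rfl⟩, ?_⟩, rfl⟩
      · simpa using (hi hy).2
      · rw [inv_mul_cancel]
        rfl
    · rintro ⟨_, ⟨⟨a, b, ha, hb, rfl⟩, h⟩, rfl⟩
      have h' : a * b = 1 := Subtype.ext h
      refine ⟨b, ?_, rfl⟩
      rwa [Set.mem_inv, inv_eq_of_mul_eq_one_left h']
  unfold IsDefinableIn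
  rw [this]
  exact (hdef i).image_comp _

/-- Being covered by `m` translates of a member of a definable family is a definable condition. -/
theorem definable_covers (hU : IsSaturatedVDefinableGroup L κ U) {X : Set U}
    (hX : IsDefinableIn L X) {β : Type} [Finite β] {Q : Set (β ⊕ Fin n → M)}
    (hQ : IsDefinable L Q) (m : ℕ) :
    IsDefinable L {b : β → M | ∃ h : Fin m → U,
      X ⊆ ⋃ j, h j • {w : U | w ∈ X ∧ Sum.elim b (w : Fin n → M) ∈ Q}} := by
  classical
  -- A translating element that is of any use has the form `x * w⁻¹` with `x, w ∈ X`, so quantifying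
  -- over `X * X⁻¹` loses nothing.
  have hG := hU.definable_mulGraph (hU.mul hX (hU.inv hX)) hX
  have h1 : ∀ j : Fin m, IsDefinable L
      {z : (β ⊕ (Fin m × Fin n)) ⊕ Fin n → M | ∃ w : Fin n → M, Sum.elim z w ∈
        (fun y => y ∘ Sum.elim (fun i => Sum.inl (Sum.inl (Sum.inr (j, i))))
          (Sum.elim (fun i => Sum.inr i) fun i => Sum.inl (Sum.inr i))) ⁻¹' mulGraph (X * X⁻¹) X ∩
        (fun y => y ∘ Sum.elim (fun i => Sum.inl (Sum.inl (Sum.inl i))) fun i => Sum.inr i) ⁻¹' Q} :=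
    fun j => Set.Definable.exists_of_finite ((hG.preimage_comp _).inter (hQ.preimage_comp _))
  have h2 := (((Set.Definable.preimage_comp
    (Sum.inr : Fin n → (β ⊕ (Fin m × Fin n)) ⊕ Fin n) hX).compl.union
    (Set.definable_iUnion_of_finite h1)).forall_of_finite).exists_of_finite
  refine (congrArg (IsDefinable L) (Set.ext fun b => ?_)).mpr h2
  have e1 : ∀ (u : Fin m × Fin n → M) (x w : Fin n → M) (j : Fin m),
      Sum.elim (Sum.elim (Sum.elim b u) x) w ∘
        Sum.elim (fun i => Sum.inl (Sum.inl (Sum.inr (j, i))))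
          (Sum.elim (fun i => Sum.inr i) fun i => Sum.inl (Sum.inr i)) =
      Sum.elim (fun i => u (j, i)) (Sum.elim w x) := fun u x w j => by
    funext i
    rcases i with i | i | i <;> rfl
  have e2 : ∀ (u : Fin m × Fin n → M) (x w : Fin n → M),
      Sum.elim (Sum.elim (Sum.elim b u) x) w ∘
        Sum.elim (fun i => Sum.inl (Sum.inl (Sum.inl i))) (fun i => Sum.inr i) =
      Sum.elim b w := fun u x w => by
    funext i
    rcases i with i | i <;> rfl
  constructor
  · rintro ⟨h, hh⟩
    refine ⟨fun p => (h p.1 : Fin n → M) p.2, fun x => ?_⟩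
    by_cases hx : x ∈ (fun g : U => (g : Fin n → M)) '' X
    · obtain ⟨x, hxX, rfl⟩ := hx
      obtain ⟨j, w, ⟨hwX, hwQ⟩, hw⟩ := Set.mem_iUnion.1 (hh hxX)
      simp only [smul_eq_mul] at hw
      refine Or.inr (Set.mem_iUnion.2 ⟨j, w, ?_, ?_⟩)
      · rw [Set.mem_preimage, e1, mem_mulGraph]
        refine ⟨h j, ⟨x, hxX, w⁻¹, Set.inv_mem_inv.2 hwX, ?_⟩, w, hwX, rfl, rfl, congrArg _ hw⟩
        simp [← hw]
      · rw [Set.mem_preimage, e2]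
        exact hwQ
    · exact Or.inl hx
  · rintro ⟨u, hu⟩
    -- The value `1` is a default: a block of `u` outside `U` covers no point.
    refine ⟨fun j => if hj : (fun i => u (j, i)) ∈ U then ⟨_, hj⟩ else 1, fun x hx => ?_⟩
    rcases hu x with hux | hux
    · exact absurd ⟨x, hx, rfl⟩ hux
    · obtain ⟨j, w, h3, h4⟩ := Set.mem_iUnion.1 hux
      rw [Set.mem_preimage, e1, mem_mulGraph] at h3
      rw [Set.mem_preimage, e2] at h4
      obtain ⟨a, -, w, hw, ha, rfl, hx'⟩ := h3
      have haU : (fun i => u (j, i)) ∈ U := ha ▸ a.2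
      refine Set.mem_iUnion.2 ⟨j, w, ⟨hw, h4⟩, ?_⟩
      have ha' : (⟨_, haU⟩ : U) = a := Subtype.ext ha.symm
      simp only [dif_pos haU, ha', smul_eq_mul]
      exact Subtype.ext hx'

end IsSaturatedVDefinableGroup

end GroupDefinability

/-! ### Generic sets and their stabilizers. -/

section Generic

variable {L : FirstOrder.Language.{u, v}} {M : Type w} [L.Structure M] {κ : Cardinal.{w}}
variable {n : ℕ} {U : Set (Fin n → M)} [CommGroup U]

theorem isGeneric_iff {X : Set U} :
    IsGeneric κ X ↔ ∃ A : Set U, #A < κ ∧ ∀ u, ∃ a ∈ A, a⁻¹ * u ∈ X := by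
  have h : IsRightGeneric κ X ↔ IsLeftGeneric κ X := by
    simp only [IsRightGeneric, IsLeftGeneric, op_smul_eq_smul]
  rw [IsGeneric, h, and_self, IsLeftGeneric]
  simp only [Set.eq_univ_iff_forall, Set.mem_iUnion, Set.mem_smul_set_iff_inv_smul_mem, smul_eq_mul,
    exists_prop]

theorem IsGeneric.mono {X Y : Set U} (hX : IsGeneric κ X) (h : X ⊆ Y) : IsGeneric κ Y := by
  rw [isGeneric_iff] at hX ⊢
  obtain ⟨A, hA, hAX⟩ := hX
  exact ⟨A, hA, fun u => (hAX u).imp fun a ha => ⟨ha.1, h ha.2⟩⟩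

theorem IsGeneric.of_cover (hκ : ℵ₀ ≤ κ) {X W : Set U} (hX : IsGeneric κ X) {T : Set U}
    (hT : #T < κ) (h : ∀ x ∈ X, ∃ t ∈ T, t⁻¹ * x ∈ W) : IsGeneric κ W := by
  rw [isGeneric_iff] at hX ⊢
  obtain ⟨A, hA, hAX⟩ := hX
  refine ⟨A * T, Cardinal.mk_mul_le.trans_lt (Cardinal.mul_lt_of_lt hκ hA hT), fun u => ?_⟩
  obtain ⟨a, ha, hau⟩ := hAX u
  obtain ⟨t, ht, htu⟩ := h _ hau
  exact ⟨a * t, Set.mul_mem_mul ha ht, by rwa [mul_inv_rev, mul_assoc]⟩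

theorem IsGeneric.of_finite_cover (hκ : ℵ₀ ≤ κ) {X W : Set U} (hX : IsGeneric κ X) {ι : Type*}
    [Finite ι] {t : ι → U} (h : X ⊆ ⋃ i, t i • W) : IsGeneric κ W := by
  refine hX.of_cover hκ (T := Set.range t) ((Cardinal.lt_aleph0_of_finite _).trans_le hκ)
    fun x hx => ?_
  obtain ⟨i, hi⟩ := Set.mem_iUnion.1 (h hx)
  exact ⟨t i, ⟨i, rfl⟩, Set.mem_smul_set_iff_inv_smul_mem.1 hi⟩

theorem IsGeneric.smul (hκ : ℵ₀ ≤ κ) {X : Set U} (hX : IsGeneric κ X) (g : U) :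
    IsGeneric κ (g • X) :=
  hX.of_finite_cover hκ (t := fun _ : Unit => g⁻¹) fun x hx =>
    Set.mem_iUnion.2 ⟨(), by simpa using hx⟩

theorem isGeneric_smul_iff (hκ : ℵ₀ ≤ κ) {X : Set U} {g : U} :
    IsGeneric κ (g • X) ↔ IsGeneric κ X :=
  ⟨fun h => by simpa using h.smul hκ g⁻¹, fun h => h.smul hκ g⟩

theorem isGeneric_of_hasBoundedIndex {K : Subgroup U} (hK : HasBoundedIndex κ K) {X : Set U}
    (h : (K : Set U) ⊆ X) : IsGeneric κ X := by
  refine isGeneric_iff.2 ⟨Set.range (Quotient.out : U ⧸ K → U), Cardinal.mk_range_le.trans_lt hK,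
    fun u => ⟨_, ⟨(u : U ⧸ K), rfl⟩, h ?_⟩⟩
  exact QuotientGroup.eq.1 (QuotientGroup.out_eq' (u : U ⧸ K))

/-- Boundedly many translates of `W` cover the group, hence `X`; compactness leaves finitely many.
-/
theorem IsSaturatedVDefinableGroup.exists_cover_of_isGeneric
    (hU : IsSaturatedVDefinableGroup L κ U) {X W : Set U} (hX : IsDefinableIn L X)
    (hW : IsDefinableIn L W) (hgen : IsGeneric κ W) :
    ∃ (m : ℕ) (h : Fin m → U), X ⊆ ⋃ j, h j • W := by
  obtain ⟨A, hA, hAW⟩ := isGeneric_iff.1 hgen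
  obtain ⟨s, hs⟩ := hU.exists_finset_cover hA (C := fun a : A => (a : U) • W)
    (fun a => hU.smul _ hW) hX (fun x _ => by
      obtain ⟨a, ha, hax⟩ := hAW x
      exact Set.mem_iUnion.2 ⟨⟨a, ha⟩, Set.mem_smul_set_iff_inv_smul_mem.2 hax⟩)
  refine ⟨s.card, fun j => (s.equivFin.symm j : A), fun x hx => ?_⟩
  obtain ⟨a, ha, hax⟩ := Set.mem_iUnion₂.1 (hs hx)
  exact Set.mem_iUnion.2 ⟨s.equivFin ⟨a, ha⟩, by simpa using hax⟩

theorem IsSaturatedVDefinableGroup.pos_of_isGeneric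
    (hU : IsSaturatedVDefinableGroup L κ U) {X W : Set U} (hX : IsDefinableIn L X)
    (hW : IsDefinableIn L W) (hgen : IsGeneric κ W) {μ : Set U → ℝ} (hμ : IsMean X μ)
    (hWX : W ⊆ X) : 0 < μ W := by
  obtain ⟨m, h, hh⟩ := hU.exists_cover_of_isGeneric hX hW hgen
  exact hμ.pos_of_cover hWX hh

theorem NonGenericIdeal.exists_isGeneric (hid : NonGenericIdeal L κ U) {ι : Type*} (s : Finset ι)
    {C : ι → Set U} (hC : ∀ i, IsDefinableIn L (C i))
    (h : IsGeneric κ (⋃ i ∈ s, C i)) : ∃ i ∈ s, IsGeneric κ (C i) := by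
  classical
  have hdef : ∀ s : Finset ι, IsDefinableIn L (⋃ i ∈ s, C i) := by
    intro s
    induction s using Finset.induction_on with
    | empty =>
      simp only [IsDefinableIn, Finset.notMem_empty, Set.iUnion_of_empty, Set.iUnion_empty,
        Set.image_empty]
      exact Set.definable_empty
    | insert i s _ ih =>
      rw [Finset.set_biUnion_insert]
      exact (hC i).union ih
  by_contra! H
  refine absurd h ?_
  clear h
  induction s using Finset.induction_on with
  | empty => simpa using hid.empty
  | insert i s _ ih =>
    rw [Finset.set_biUnion_insert]
    exact hid.union _ _ (hC i) (hdef s) (H i (Finset.mem_insert_self _ _))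
      (ih fun j hj => H j (Finset.mem_insert_of_mem hj))

theorem NonGenericIdeal.of_subset_union (hid : NonGenericIdeal L κ U) {X Y Z : Set U}
    (hY : IsDefinableIn L Y) (hZ : IsDefinableIn L Z) (h : X ⊆ Y ∪ Z) (hYn : ¬ IsGeneric κ Y)
    (hZn : ¬ IsGeneric κ Z) : ¬ IsGeneric κ X :=
  fun hX => hid.union _ _ hY hZ hYn hZn (hX.mono h)

/-- `Stab_ng(X)` as a subgroup. -/
def IsSaturatedVDefinableGroup.stab (hU : IsSaturatedVDefinableGroup L κ U)
    (hid : NonGenericIdeal L κ U) {X : Set U} (hX : IsDefinableIn L X) : Subgroup U where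
  carrier := stabNG κ X
  one_mem' := by
    simpa only [stabNG, Set.mem_ofPred_eq, one_smul, symmDiff_self, Set.bot_eq_empty] using hid.empty
  inv_mem' := by
    intro g hg
    have : symmDiff (g⁻¹ • X) X = g⁻¹ • symmDiff (g • X) X := by
      rw [Set.smul_set_symmDiff, inv_smul_smul, symmDiff_comm]
    simpa only [stabNG, Set.mem_ofPred_eq, this, isGeneric_smul_iff hU.aleph0_lt.le] using hg
  mul_mem' := by
    intro g h hg hh
    refine hid.of_subset_union (hU.smul g ((hU.smul h hX).symmDiff hX))
      ((hU.smul g hX).symmDiff hX) ?_ (by rwa [isGeneric_smul_iff hU.aleph0_lt.le]) hg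
    rw [Set.smul_set_symmDiff, mul_smul]
    intro x
    simp only [Set.mem_symmDiff, Set.mem_union]
    tauto

/-- If `g ∉ X * X⁻¹`, then `g • X` is disjoint from `X`, and the symmetric difference contains the
generic set `X`. -/
theorem stabNG_subset {X : Set U} (hX : IsGeneric κ X) : stabNG κ X ⊆ X * X⁻¹ := by
  intro g hg
  by_contra hno
  refine hg (hX.mono fun x hx => Or.inr ⟨hx, fun hgx => hno ?_⟩)
  exact ⟨x, hx, (g⁻¹ * x)⁻¹, Set.inv_mem_inv.2 (Set.mem_smul_set_iff_inv_smul_mem.1 hgx), by simp⟩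

/-- The stabilizer depends only on `X` modulo non-generic sets: passing from `X` to `Y` changes
`symmDiff (g • X) X` only within `symmDiff X Y` and its translate by `g`. -/
theorem IsSaturatedVDefinableGroup.stabNG_subset_stabNG (hU : IsSaturatedVDefinableGroup L κ U)
    (hid : NonGenericIdeal L κ U) {X Y : Set U} (hX : IsDefinableIn L X) (hY : IsDefinableIn L Y)
    (h : ¬ IsGeneric κ (symmDiff X Y)) : stabNG κ X ⊆ stabNG κ Y := by
  intro g hg
  have hd := hX.symmDiff hY
  refine hid.of_subset_union (hd.union (hU.smul g hd)) ((hU.smul g hX).symmDiff hX) ?_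
    (hid.union _ _ hd (hU.smul g hd) h (by rwa [isGeneric_smul_iff hU.aleph0_lt.le])) hg
  rw [Set.smul_set_symmDiff]
  intro x
  simp only [Set.mem_symmDiff, Set.mem_union]
  tauto

/-- The candidates `g` lie in `Z = X * X⁻¹`, and for them `symmDiff (g • X) X` is a subset of the
generic set `Y = Z * X ∪ X`. It is generic exactly when some number `m` of its translates covers
`Y`; `D m` forbids this for `m`. -/
theorem IsSaturatedVDefinableGroup.stabNG_eq_iInter (hU : IsSaturatedVDefinableGroup L κ U)
    {X : Set U} (hX : IsDefinableIn L X) (hgen : IsGeneric κ X) :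
    ∃ D : ℕ → Set (Fin n → M), (∀ m, IsDefinable L (D m)) ∧
      (fun g : U => (g : Fin n → M)) '' stabNG κ X = ⋂ m, D m := by
  have hZ := hU.mul hX (hU.inv hX)
  set Z := X * X⁻¹
  have hY := (hU.mul hZ hX).union hX
  set Y := Z * X ∪ X
  have hYgen : IsGeneric κ Y := hgen.mono Set.subset_union_right
  let P : Set (Fin n ⊕ Fin n → M) := {z | ∃ x : Fin n → M, Sum.elim z x ∈
    (fun y : (Fin n ⊕ Fin n) ⊕ Fin n → M => y ∘ Sum.elim (fun i => Sum.inl (Sum.inl i))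
      (Sum.elim (fun i => Sum.inr i) fun i => Sum.inl (Sum.inr i))) ⁻¹' mulGraph Z X}
  let R : Set (Fin n ⊕ Fin n → M) := (fun z => z ∘ Sum.inr) ⁻¹' ((fun g : U => (g : Fin n → M)) '' X)
  have hP : IsDefinable L P :=
    Set.Definable.exists_of_finite ((hU.definable_mulGraph hZ hX).preimage_comp _)
  have hR : IsDefinable L R := Set.Definable.preimage_comp _ hX
  have hQ : IsDefinable L (P \ R ∪ R \ P) := (hP.sdiff hR).union (hR.sdiff hP)
  have hPmem : ∀ g ∈ Z, ∀ w : U, Sum.elim (g : Fin n → M) (w : Fin n → M) ∈ P ↔ w ∈ g • X := by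
    intro g hg w
    have e : ∀ x : Fin n → M, Sum.elim (Sum.elim (g : Fin n → M) (w : Fin n → M)) x ∘
        Sum.elim (fun i => Sum.inl (Sum.inl i))
          (Sum.elim (fun i => Sum.inr i) fun i => Sum.inl (Sum.inr i)) =
        Sum.elim (g : Fin n → M) (Sum.elim x (w : Fin n → M)) := fun x => by
      funext i
      rcases i with i | i | i <;> rfl
    simp only [P, Set.mem_ofPred_eq, Set.mem_preimage, e, mem_mulGraph]
    constructor
    · rintro ⟨_, a, -, x, hx, ha, -, hw⟩
      have ha' : a = g := Subtype.ext ha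
      subst ha'
      exact ⟨x, hx, Subtype.ext hw⟩
    · rintro ⟨x, hx, hw⟩
      exact ⟨x, g, hg, x, hx, rfl, rfl, congrArg _ hw⟩
  have hRmem : ∀ (g : Fin n → M) (w : U), Sum.elim g (w : Fin n → M) ∈ R ↔ w ∈ X := fun g w =>
    Subtype.val_injective.mem_set_image
  have hW : ∀ g ∈ Z, {w : U | w ∈ Y ∧
      Sum.elim (g : Fin n → M) (w : Fin n → M) ∈ P \ R ∪ R \ P} = symmDiff (g • X) X := by
    intro g hg
    ext w
    have h1 : w ∈ g • X → w ∈ Y := fun hw => by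
      obtain ⟨x, hx, rfl⟩ := hw
      exact Or.inl (Set.mul_mem_mul hg hx)
    have h2 : w ∈ X → w ∈ Y := fun hw => Or.inr hw
    simp only [Set.mem_ofPred_eq, Set.mem_union, Set.mem_sdiff, hPmem g hg, hRmem, Set.mem_symmDiff]
    tauto
  refine ⟨fun m => (fun g : U => (g : Fin n → M)) '' Z \ {b | ∃ h : Fin m → U,
    Y ⊆ ⋃ j, h j • {w : U | w ∈ Y ∧ Sum.elim b (w : Fin n → M) ∈ P \ R ∪ R \ P}},
    fun m => Set.Definable.sdiff hZ (hU.definable_covers hY hQ m), ?_⟩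
  ext b
  rw [Set.mem_iInter]
  constructor
  · rintro ⟨g, hg, rfl⟩ m
    have hgZ := stabNG_subset hgen hg
    refine ⟨⟨g, hgZ, rfl⟩, ?_⟩
    rintro ⟨h, hh⟩
    rw [hW g hgZ] at hh
    exact hg (hYgen.of_finite_cover hU.aleph0_lt.le hh)
  · intro hb
    obtain ⟨⟨g, hgZ, rfl⟩, -⟩ := hb 0
    refine ⟨g, fun hg => ?_, rfl⟩
    obtain ⟨m, h, hh⟩ := hU.exists_cover_of_isGeneric hY ((hU.smul g hX).symmDiff hX) hg
    refine (hb m).2 ⟨h, ?_⟩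
    rw [hW g hgZ]
    exact hh

end Generic

/-! ### Families of fibers and the count of codes. -/

section Index

variable {L : FirstOrder.Language.{u, v}} {M : Type w} [L.Structure M] {κ : Cardinal.{w}}
variable {n : ℕ} {U : Set (Fin n → M)}

/-- The elements of `V` that satisfy `φ(c, x)`. -/
def fiber (V : Set U) {k : ℕ} (φ : L.Formula (Fin k ⊕ Fin n)) (c : Fin k → M) : Set U :=
  V ∩ {x : U | (x : Fin n → M) ∈ {x | φ.Realize (Sum.elim c x)}}

theorem isDefinable_fiber {k : ℕ} (φ : L.Formula (Fin k ⊕ Fin n)) (c : Fin k → M) :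
    IsDefinable L {x : Fin n → M | φ.Realize (Sum.elim c x)} := by
  have h := ((isDefinable_realize φ).inter
    ((isDefinable_singleton c).preimage_comp (Sum.inl : Fin k → Fin k ⊕ Fin n))).image_comp
      (Sum.inr : Fin n → Fin k ⊕ Fin n)
  refine (congrArg (IsDefinable L) (Set.ext fun x => ?_)).mpr h
  constructor
  · intro hx
    exact ⟨Sum.elim c x, ⟨hx, rfl⟩, rfl⟩
  · rintro ⟨z, ⟨hz, hzc⟩, rfl⟩
    have hzc' : z ∘ Sum.inl = c := hzc
    simpa only [Set.mem_ofPred_eq, ← hzc', Sum.elim_comp_inl_inr] using hz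

theorem IsDefinableIn.fiber {V : Set U} (hV : IsDefinableIn L V) {k : ℕ}
    (φ : L.Formula (Fin k ⊕ Fin n)) (c : Fin k → M) : IsDefinableIn L (fiber V φ c) :=
  hV.inter_preimage (isDefinable_fiber φ c)

theorem IsDefinableIn.exists_eq_fiber {V X : Set U} (hX : IsDefinableIn L X) (h : X ⊆ V) :
    ∃ (p : Σ k : ℕ, L.Formula (Fin k ⊕ Fin n)) (c : Fin p.1 → M), X = VDef.fiber V p.2 c := by
  obtain ⟨k, φ, c, hφ⟩ := IsDefinable.exists_formula hX
  refine ⟨⟨k, φ⟩, c, ?_⟩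
  ext x
  simp only [VDef.fiber, ← hφ, Set.mem_inter_iff, Set.mem_ofPred_eq,
    Subtype.val_injective.mem_set_image]
  exact ⟨fun hx => ⟨h hx, hx⟩, fun hx => hx.2⟩

theorem IsSaturatedVDefinableGroup.exists_notShatter [CommGroup U]
    (hU : IsSaturatedVDefinableGroup L κ U) (hNIP : IsNIP L M) {V : Set U}
    (hV : IsDefinableIn L V) {k : ℕ} (φ : L.Formula (Fin k ⊕ Fin n)) :
    ∃ D, NotShatter {S | ∃ g ∈ V, ∃ Y ∈ Set.range (fiber V φ), S = g • Y} D := by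
  let R : Set (Fin n ⊕ (Fin n ⊕ Fin k) → M) := {z | ∃ u : Fin n → M, Sum.elim z u ∈
    (fun y : (Fin n ⊕ (Fin n ⊕ Fin k)) ⊕ Fin n → M => y ∘ Sum.elim
      (fun i => Sum.inl (Sum.inr (Sum.inl i)))
      (Sum.elim (fun i => Sum.inr i) fun i => Sum.inl (Sum.inl i))) ⁻¹' mulGraph V V ∩
    (fun y => y ∘ Sum.elim (fun i => Sum.inl (Sum.inr (Sum.inr i))) fun i => Sum.inr i) ⁻¹'
      {z | φ.Realize z}}
  have hR : IsDefinable L R := Set.Definable.exists_of_finite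
    (((hU.definable_mulGraph hV hV).preimage_comp _).inter
      ((isDefinable_realize φ).preimage_comp _))
  have hmem : ∀ (w : U), ∀ g ∈ V, ∀ c : Fin k → M,
      Sum.elim (w : Fin n → M) (Sum.elim (g : Fin n → M) c) ∈ R ↔ w ∈ g • fiber V φ c := by
    intro w g hg c
    have e1 : ∀ x : Fin n → M, Sum.elim (Sum.elim (w : Fin n → M) (Sum.elim (g : Fin n → M) c)) x ∘
        Sum.elim (fun i => Sum.inl (Sum.inr (Sum.inl i)))
          (Sum.elim (fun i => Sum.inr i) fun i => Sum.inl (Sum.inl i)) =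
        Sum.elim (g : Fin n → M) (Sum.elim x (w : Fin n → M)) := fun x => by
      funext i
      rcases i with i | i | i <;> rfl
    have e2 : ∀ x : Fin n → M, Sum.elim (Sum.elim (w : Fin n → M) (Sum.elim (g : Fin n → M) c)) x ∘
        Sum.elim (fun i => Sum.inl (Sum.inr (Sum.inr i))) (fun i => Sum.inr i) =
        Sum.elim c x := fun x => by
      funext i
      rcases i with i | i <;> rfl
    simp only [R, Set.mem_ofPred_eq, Set.mem_preimage, Set.mem_inter_iff, e1, e2, mem_mulGraph]
    constructor
    · rintro ⟨_, ⟨a, -, x, hx, ha, rfl, hw⟩, hxc⟩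
      have ha' : a = g := Subtype.ext ha
      subst ha'
      exact ⟨x, ⟨hx, hxc⟩, Subtype.ext hw⟩
    · rintro ⟨x, ⟨hx, hxc⟩, hw⟩
      exact ⟨x, ⟨g, hg, x, hx, rfl, rfl, congrArg _ hw⟩, hxc⟩
  obtain ⟨D, hD⟩ := hNIP.exists_not_shatter hR
  refine ⟨D, fun ⟨a, b, hb, hab⟩ => hD ?_⟩
  choose g hg Y hY hbY using hb
  choose c hc using hY
  refine ⟨fun i => (a i : Fin n → M), fun S => Sum.elim (g S : Fin n → M) (c S), fun i S => ?_⟩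
  rw [hmem _ _ (hg S), hc, ← hbY]
  exact hab i S

/-- This is where the lower bound on the cardinal enters the count: there are at most `2 ^ max ℵ₀
L.card` codes, a code being a choice of countable data for each formula. -/
theorem mk_lt_of_injective_set {c : Cardinal.{w}}
    (hc : Cardinal.lift.{w} ((2 : Cardinal.{max u v}) ^ max ℵ₀ L.card) <
      Cardinal.lift.{max u v} c) {R : Type w}
    (f : R → Set ((Σ k : ℕ, L.Formula (Fin k ⊕ Fin n)) × ℕ × ℕ × ℕ)) (hf : Function.Injective f) :
    #R < c := by
  have h1 := Cardinal.lift_mk_le_lift_mk_of_injective hf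
  have h2 : #(Set ((Σ k : ℕ, L.Formula (Fin k ⊕ Fin n)) × ℕ × ℕ × ℕ)) ≤
      (2 : Cardinal.{max u v}) ^ max ℵ₀ L.card := by
    rw [Cardinal.mk_set]
    refine Cardinal.power_le_power_left two_ne_zero ?_
    rw [Cardinal.mk_prod, Cardinal.mk_eq_aleph0 (ℕ × ℕ × ℕ), Cardinal.lift_aleph0]
    refine (Cardinal.mul_le_max _ _).trans ?_
    have := card_formula_le L n
    refine max_le (max_le ?_ (le_max_left _ _)) (le_max_left _ _)
    simpa using this
  refine Cardinal.lift_lt.1 (h1.trans_lt (lt_of_le_of_lt ?_ hc))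
  exact Cardinal.lift_le.2 h2

end Index

/-! ### Bounded index, type-definability and minimality. -/

section Main

variable {L : FirstOrder.Language.{u, v}} {M : Type w} [L.Structure M] {κ : Cardinal.{w}}
variable {n : ℕ} {U : Set (Fin n → M)} [CommGroup U]

namespace IsSaturatedVDefinableGroup

/-- The intersection of the groups `Stab_ng(X)` over all generic definable `X ⊆ V`. -/
def stabInf (hU : IsSaturatedVDefinableGroup L κ U) (hid : NonGenericIdeal L κ U) (V : Set U) :
    Subgroup U :=
  ⨅ X : {X : Set U // IsDefinableIn L X ∧ X ⊆ V ∧ IsGeneric κ X}, hU.stab hid X.2.1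

theorem mem_stabInf (hU : IsSaturatedVDefinableGroup L κ U) (hid : NonGenericIdeal L κ U)
    {V : Set U} {g : U} : g ∈ hU.stabInf hid V ↔
      ∀ X, IsDefinableIn L X → X ⊆ V → IsGeneric κ X → g ∈ stabNG κ X := by
  rw [stabInf, Subgroup.mem_iInf]
  exact ⟨fun h X h1 h2 h3 => h ⟨X, h1, h2, h3⟩, fun h X => h X X.2.1 X.2.2.1 X.2.2.2⟩

theorem hasBoundedIndex_stabInf (hU : IsSaturatedVDefinableGroup L κ U)
    (hid : NonGenericIdeal L κ U) (hNIP : IsNIP L M)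
    (hκ : Cardinal.lift.{w} ((2 : Cardinal.{max u v}) ^ max ℵ₀ L.card) <
      Cardinal.lift.{max u v} κ) {V : Set U} (hV : IsDefinableIn L V) (hgen : IsGeneric κ V)
    (h1 : 1 ∈ V) : HasBoundedIndex κ (hU.stabInf hid V) := by
  have hVV := hU.mul hV hV
  -- The mean lives on `V * V` because the translates `g • X` with `g ∈ V` and `X ⊆ V` must lie in
  -- its domain of positivity.
  obtain ⟨μ, hμ⟩ := exists_isMean (X := V * V) ⟨1, 1, h1, 1, h1, one_mul 1⟩
  have hsub : V ⊆ V * V := fun x hx => ⟨1, h1, x, hx, one_mul x⟩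
  choose D hD using fun p : Σ k : ℕ, L.Formula (Fin k ⊕ Fin n) =>
    hU.exists_notShatter hNIP hV p.2
  choose code hcode using fun p : Σ k : ℕ, L.Formula (Fin k ⊕ Fin n) =>
    hμ.exists_smul_code (V := V) (ℱ := Set.range (fiber V p.2))
      (by rintro _ ⟨c, rfl⟩; exact Set.inter_subset_left.trans hsub) h1 (hD p)
  let C : U → Set ((Σ k : ℕ, L.Formula (Fin k ⊕ Fin n)) × ℕ × ℕ × ℕ) :=
    fun g => {q | q.2 ∈ code q.1 g}
  have hC : ∀ g ∈ V, ∀ g' ∈ V, C g = C g' → g⁻¹ * g' ∈ hU.stabInf hid V := by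
    intro g hg g' hg' h
    refine (hU.mem_stabInf hid).2 fun X hX hXV _ hXg => ?_
    obtain ⟨p, c, rfl⟩ := hX.exists_eq_fiber hXV
    have hp : code p g = code p g' := Set.ext fun q => Set.ext_iff.1 h (p, q)
    have hle := hcode p g hg g' hg' hp _ ⟨c, rfl⟩
    refine hle.not_gt (hU.pos_of_isGeneric hVV ((hU.smul g hX).symmDiff (hU.smul g' hX)) ?_ hμ ?_)
    · rw [← isGeneric_smul_iff hU.aleph0_lt.le (g := g⁻¹), Set.smul_set_symmDiff, inv_smul_smul,
        smul_smul, symmDiff_comm]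
      exact hXg
    · rintro x (⟨hx, -⟩ | ⟨hx, -⟩) <;> obtain ⟨y, hy, rfl⟩ := hx
      · exact Set.mul_mem_mul hg (hXV hy)
      · exact Set.mul_mem_mul hg' (hXV hy)
  obtain ⟨A, hA, hAV⟩ := isGeneric_iff.1 hgen
  choose a ha haV using hAV
  have hR : #(Quotient (Setoid.ker C)) < κ :=
    mk_lt_of_injective_set hκ (Setoid.kerLift C) (Setoid.kerLift_injective C)
  -- A coset representative is written `a * v` with `a ∈ A` and `v ∈ V`; the coset is determined by
  -- `a` and the code of `v`.
  have hinj : Function.Injective fun q : U ⧸ hU.stabInf hid V =>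
      ((⟨a q.out, ha q.out⟩ : A), (Quotient.mk (Setoid.ker C) ((a q.out)⁻¹ * q.out))) := by
    intro q r hqr
    simp only [Prod.mk.injEq, Subtype.mk.injEq, Quotient.eq] at hqr
    have := hC _ (haV q.out) _ (haV r.out) hqr.2
    rw [hqr.1, mul_inv_rev, inv_inv, mul_assoc, mul_inv_cancel_left] at this
    rw [← QuotientGroup.out_eq' q, ← QuotientGroup.out_eq' r]
    exact QuotientGroup.eq.2 this
  refine (Cardinal.mk_le_of_injective hinj).trans_lt ?_
  rw [Cardinal.mk_prod, Cardinal.lift_id, Cardinal.lift_id]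
  exact Cardinal.mul_lt_of_lt hU.aleph0_lt.le hA hR

/-- Two fibers of one formula with equal codes differ by a set of measure zero, hence a non-generic
one, and so have the same stabilizer. -/
theorem mk_stabNG_lt (hU : IsSaturatedVDefinableGroup L κ U)
    (hid : NonGenericIdeal L κ U) (hNIP : IsNIP L M)
    (hκ : Cardinal.lift.{w} ((2 : Cardinal.{max u v}) ^ max ℵ₀ L.card) <
      Cardinal.lift.{max u v} κ) {V : Set U} (hV : IsDefinableIn L V) (h1 : 1 ∈ V) :
    #{S : Set U | ∃ X, IsDefinableIn L X ∧ X ⊆ V ∧ IsGeneric κ X ∧ S = stabNG κ X} < κ := by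
  obtain ⟨μ, hμ⟩ := exists_isMean (X := V) ⟨1, h1⟩
  choose D hD using fun p : Σ k : ℕ, L.Formula (Fin k ⊕ Fin n) =>
    hU.exists_notShatter hNIP hV p.2
  choose code hcode using fun p : Σ k : ℕ, L.Formula (Fin k ⊕ Fin n) =>
    hμ.exists_code ((hD p).mono (𝒢 := Set.range (fiber V p.2))
      fun Y hY => ⟨1, h1, Y, hY, (one_smul _ Y).symm⟩)
  have hex : ∀ S : {S : Set U | ∃ X, IsDefinableIn L X ∧ X ⊆ V ∧ IsGeneric κ X ∧ S = stabNG κ X},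
      ∃ (p : Σ k : ℕ, L.Formula (Fin k ⊕ Fin n)) (c : Fin p.1 → M),
        (S : Set U) = stabNG κ (fiber V p.2 c) := by
    rintro ⟨_, X, hX, hXV, -, rfl⟩
    obtain ⟨p, c, rfl⟩ := hX.exists_eq_fiber hXV
    exact ⟨p, c, rfl⟩
  choose p c hpc using hex
  -- The tag `0` records the formula even when the code is empty; the tag `1` carries the code
  -- itself.
  refine mk_lt_of_injective_set hκ (L := L) (n := n) (fun S => {q | q.1 = p S ∧
    (q.2 = (0, 0, 0) ∨ ∃ r ∈ code (p S) (fiber V (p S).2 (c S)), q.2 = (1, r))}) ?_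
  intro S T hST
  have hp : p S = p T := ((Set.ext_iff.1 hST (p S, 0, 0, 0)).1 ⟨rfl, Or.inl rfl⟩).1
  have hc : code (p S) (fiber V (p S).2 (c S)) = code (p S) (fiber V (p T).2 (c T)) := by
    ext ⟨r, r'⟩
    have := Set.ext_iff.1 hST (p S, 1, r, r')
    simpa [hp] using this
  refine Subtype.ext ?_
  rw [hpc S, hpc T]
  have hle := hcode (p S) _ ⟨c S, rfl⟩ (fiber V (p T).2 (c T)) (by rw [hp]; exact ⟨c T, rfl⟩) hc
  have hS := hV.fiber (p S).2 (c S)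
  have hT := hV.fiber (p T).2 (c T)
  have hng : ¬ IsGeneric κ (symmDiff (fiber V (p S).2 (c S)) (fiber V (p T).2 (c T))) := by
    intro h
    refine hle.not_gt (hU.pos_of_isGeneric hV (hS.symmDiff hT) h hμ ?_)
    rintro x (⟨hx, -⟩ | ⟨hx, -⟩) <;> exact hx.1
  refine (hU.stabNG_subset_stabNG hid hS hT hng).antisymm
    (hU.stabNG_subset_stabNG hid hT hS ?_)
  rwa [symmDiff_comm]

theorem isTypeDefinableIn_stabNG (hU : IsSaturatedVDefinableGroup L κ U) {X : Set U}
    (hX : IsDefinableIn L X) (hgen : IsGeneric κ X) : IsTypeDefinableIn L κ (stabNG κ X) := by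
  obtain ⟨D, hD, h⟩ := hU.stabNG_eq_iInter hX hgen
  refine ⟨ULift ℕ, fun m => D m.down, by simpa using hU.aleph0_lt, fun m => hD _, ?_⟩
  rw [h, ULift.down_surjective.iInter_comp]

theorem isTypeDefinableIn_stabInf (hU : IsSaturatedVDefinableGroup L κ U)
    (hid : NonGenericIdeal L κ U) (hNIP : IsNIP L M)
    (hκ : Cardinal.lift.{w} ((2 : Cardinal.{max u v}) ^ max ℵ₀ L.card) <
      Cardinal.lift.{max u v} κ) {V : Set U} (hV : IsDefinableIn L V) (hgen : IsGeneric κ V)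
    (h1 : 1 ∈ V) : IsTypeDefinableIn L κ (hU.stabInf hid V : Set U) := by
  have hcard := hU.mk_stabNG_lt hid hNIP hκ hV h1
  set 𝒮 := {S : Set U | ∃ X, IsDefinableIn L X ∧ X ⊆ V ∧ IsGeneric κ X ∧ S = stabNG κ X}
  have hex : ∀ S : 𝒮, ∃ D : ℕ → Set (Fin n → M), (∀ m, IsDefinable L (D m)) ∧
      (fun g : U => (g : Fin n → M)) '' S = ⋂ m, D m := by
    rintro ⟨_, X, hX, -, hXg, rfl⟩
    exact hU.stabNG_eq_iInter hX hXg
  choose D hD hSD using hex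
  refine ⟨𝒮 × ULift ℕ, fun q => D q.1 q.2.down, ?_, fun q => hD _ _, ?_⟩
  · rw [Cardinal.mk_prod, Cardinal.lift_id, Cardinal.lift_id]
    exact Cardinal.mul_lt_of_lt hU.aleph0_lt.le hcard (by simpa using hU.aleph0_lt)
  · have hinf : (hU.stabInf hid V : Set U) = ⋂ S : 𝒮, (S : Set U) := by
      ext g
      simp only [SetLike.mem_coe, Set.mem_iInter, hU.mem_stabInf hid]
      exact ⟨fun h ⟨_, X, h1, h2, h3, e⟩ => e ▸ h X h1 h2 h3,
        fun h X h1 h2 h3 => h ⟨_, X, h1, h2, h3, rfl⟩⟩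
    have : Nonempty 𝒮 := ⟨⟨_, V, hV, subset_rfl, hgen, rfl⟩⟩
    rw [hinf, Subtype.val_injective.injOn.image_iInter_eq]
    ext x
    simp only [hSD, Set.mem_iInter, Prod.forall, ULift.forall]

/-- A definable set containing a type-definable subgroup contains a "square" of a smaller one. -/
theorem exists_mul_inv_subset (hU : IsSaturatedVDefinableGroup L κ U) {K : Subgroup U}
    {ι : Type w} (hι : #ι < κ) {D : ι → Set (Fin n → M)} (hD : ∀ i, IsDefinable L (D i))
    (hK : (fun g : U => (g : Fin n → M)) '' (K : Set U) = ⋂ i, D i) {E : Set (Fin n → M)}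
    (hE : IsDefinable L E) (hKE : (fun g : U => (g : Fin n → M)) '' (K : Set U) ⊆ E) :
    ∃ Y : Set U, IsDefinableIn L Y ∧ (K : Set U) ⊆ Y ∧
      ∀ g ∈ Y * Y⁻¹, (g : Fin n → M) ∈ E := by
  obtain ⟨ι', X, hι', hX, hdir, hcov, -⟩ := hU.exists_cover
  have hne : Nonempty ι' := by
    obtain ⟨i, -⟩ := Set.mem_iUnion.1 (hcov ▸ Set.mem_univ (1 : U))
    exact ⟨i⟩
  obtain ⟨s₀, t, hst⟩ := hU.saturated.exists_finset_iInter_subset hU.aleph0_lt hι hι' hD hX (by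
    rw [← hK, ← Set.image_iUnion, hcov]
    exact Set.image_mono (Set.subset_univ _))
  obtain ⟨j, hj⟩ := hdir.finset_le t
  have hKD : ∀ g ∈ K, ∀ i, (g : Fin n → M) ∈ D i := fun g hg =>
    Set.mem_iInter.1 (hK ▸ ⟨g, hg, rfl⟩)
  have hKX : (K : Set U) ⊆ X j := by
    intro g hg
    obtain ⟨i, hi, hgi⟩ := Set.mem_iUnion₂.1 (hst (Set.mem_iInter₂.2 fun i _ => hKD g hg i))
    exact hj i hi (Subtype.val_injective.mem_set_image.1 hgi)
  -- An empty intersection is all of `M ^ n`, which forces `E` to be everything. Otherwise some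
  -- index `i₀` certifies below that the realized point comes from a pair in the group.
  rcases isEmpty_or_nonempty ι with hem | ⟨⟨i₀⟩⟩
  · refine ⟨X j, hX j, hKX, fun g _ => hKE ?_⟩
    rw [hK, Set.iInter_of_empty]
    trivial
  by_contra! H
  let B : ι → Set U := fun i => X j ∩ {g | (g : Fin n → M) ∈ D i}
  have hB : ∀ i, IsDefinableIn L (B i) := fun i => (hX j).inter_preimage (hD i)
  have hBs : ∀ s : Finset ι, IsDefinableIn L {g | g ∈ X j ∧ ∀ i ∈ s, (g : Fin n → M) ∈ D i} := by
    intro s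
    have h := (hX j).inter_preimage (Set.definable_biInter_finset hD s)
    simp only [Set.mem_iInter] at h
    exact h
  -- If no `Y` worked, saturation would produce `a` and `b⁻¹` lying in every `B i`, hence in `K`,
  -- with `a * b` outside `E ⊇ K`.
  obtain ⟨z, hz⟩ := hU.saturated.nonempty_iInter hU.aleph0_lt hι
    (C := fun i => mulGraph (B i) (B i)⁻¹ ∩ (fun z => z ∘ (Sum.inr ∘ Sum.inr)) ⁻¹' Eᶜ)
    (fun i => (hU.definable_mulGraph (hB i) (hU.inv (hB i))).inter (hE.compl.preimage_comp _)) (by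
      intro s
      obtain ⟨_, ⟨a, ha, b, hb, rfl⟩, hE'⟩ := H _ (hBs s) fun g hg => ⟨hKX hg, fun i _ => hKD g hg i⟩
      exact ⟨_, Set.mem_iInter₂.2 fun i hi =>
        ⟨⟨a, b, ⟨ha.1, ha.2 i hi⟩, ⟨hb.1, hb.2 i hi⟩, rfl⟩, hE'⟩⟩)
  rw [Set.mem_iInter] at hz
  obtain ⟨⟨a, b, -, -, rfl⟩, hzE⟩ := hz i₀
  have hmem : ∀ i, a ∈ B i ∧ b⁻¹ ∈ B i := by
    intro i
    obtain ⟨a', ha', b', hb', h1, h2, -⟩ := mem_mulGraph.1 (hz i).1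
    have h1' : a' = a := Subtype.ext h1
    have h2' : b' = b := Subtype.ext h2
    subst h1' h2'
    exact ⟨ha', hb'⟩
  have hKmem : ∀ g : U, (∀ i, g ∈ B i) → g ∈ K := by
    intro g hg
    have : (g : Fin n → M) ∈ (fun g : U => (g : Fin n → M)) '' (K : Set U) :=
      hK ▸ Set.mem_iInter.2 fun i => (hg i).2
    exact Subtype.val_injective.mem_set_image.1 this
  exact hzE (hKE ⟨a * b, K.mul_mem (hKmem a fun i => (hmem i).1)
    (K.inv_mem_iff.1 (hKmem _ fun i => (hmem i).2)), rfl⟩)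

theorem isU00_stabInf (hU : IsSaturatedVDefinableGroup L κ U)
    (hid : NonGenericIdeal L κ U) (hNIP : IsNIP L M)
    (hκ : Cardinal.lift.{w} ((2 : Cardinal.{max u v}) ^ max ℵ₀ L.card) <
      Cardinal.lift.{max u v} κ) {V : Set U} (hV : IsDefinableIn L V) (hgen : IsGeneric κ V)
    (h1 : 1 ∈ V) : IsU00 L κ (hU.stabInf hid V) where
  typeDefinable := hU.isTypeDefinableIn_stabInf hid hNIP hκ hV hgen h1
  subset_definable := ⟨V * V⁻¹, hU.mul hV (hU.inv hV), fun g hg =>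
    stabNG_subset hgen ((hU.mem_stabInf hid).1 hg V hV subset_rfl hgen)⟩
  boundedIndex := hU.hasBoundedIndex_stabInf hid hNIP hκ hV hgen h1
  le := by
    rintro K ⟨ι, D, hι, hD, hK⟩ hKi g hg
    have hgD : ∀ i, (g : Fin n → M) ∈ D i := by
      intro i
      obtain ⟨Y, hY, hKY, hYD⟩ := hU.exists_mul_inv_subset hι hD hK (hD i)
        (hK ▸ Set.iInter_subset D i)
      have hYg := isGeneric_of_hasBoundedIndex hKi hKY
      obtain ⟨m, h, hh⟩ := hU.exists_cover_of_isGeneric hY hV hgen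
      -- `Y` need not lie in `V`, but finitely many translates of `V` cover it, so one piece `Y ∩ h
      -- j • V` is generic. Moved back by `(h j)⁻¹` it is a generic subset of `V`, whose stabilizer
      -- takes part in `stabInf`.
      obtain ⟨j, -, hj⟩ := hid.exists_isGeneric Finset.univ (C := fun j => Y ∩ h j • V)
        (fun j => hY.inter (hU.smul _ hV)) (by
          refine hYg.mono fun y hy => ?_
          obtain ⟨j, hj⟩ := Set.mem_iUnion.1 (hh hy)
          exact Set.mem_iUnion₂.2 ⟨j, Finset.mem_univ j, hy, hj⟩)
      have hX := hU.smul (h j)⁻¹ (hY.inter (hU.smul (h j) hV))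
      have hXg := hj.smul hU.aleph0_lt.le (h j)⁻¹
      have hgX := stabNG_subset hXg ((hU.mem_stabInf hid).1 hg _ hX (by
        rintro _ ⟨y, ⟨-, x, hx, rfl⟩, rfl⟩
        simpa using hx) hXg)
      refine hYD g ?_
      obtain ⟨x, hx, y, hy, rfl⟩ := hgX
      rw [Set.mem_smul_set_iff_inv_smul_mem, inv_inv] at hx
      rw [Set.mem_inv, Set.mem_smul_set_iff_inv_smul_mem, inv_inv] at hy
      refine ⟨_, hx.1, _, Set.inv_mem_inv.2 hy.1, ?_⟩
      -- By commutativity the translation by `h j` cancels in the quotient of two elements.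
      simp [mul_comm, mul_left_comm]
    have : (g : Fin n → M) ∈ (fun g : U => (g : Fin n → M)) '' (K : Set U) :=
      hK ▸ Set.mem_iInter.2 hgD
    exact Subtype.val_injective.mem_set_image.1 this

end IsSaturatedVDefinableGroup

end Main

end VDef

/-! ### The theorem. -/

theorem mainTheorem3 (L : FirstOrder.Language.{u, v}) (M : Type w) [L.Structure M]
    (κ : Cardinal.{w})
    (hκ : Cardinal.lift.{w} ((2 : Cardinal.{max u v}) ^ max ℵ₀ L.card) <
      Cardinal.lift.{max u v} κ)
    (hsat : VDef.IsSaturated L M κ) (hNIP : VDef.IsNIP L M)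
    (n : ℕ) (U : Set (Fin n → M)) [CommGroup U] (hU : VDef.IsVDefinableGroup L κ U)
    (hideal : VDef.NonGenericIdeal L κ U)
    (hgen : ∃ X : Set U, VDef.IsDefinableIn L X ∧ VDef.IsGeneric κ X) :
    (∀ X : Set U, VDef.IsDefinableIn L X → VDef.IsGeneric κ X →
      ∃ H : Subgroup U, (H : Set U) = VDef.stabNG κ X ∧
        VDef.IsTypeDefinableIn L κ (H : Set U) ∧ VDef.HasBoundedIndex κ H) ∧
    ∃ H : Subgroup U, VDef.IsU00 L κ H := by
  have hκ0 : ℵ₀ < κ := by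
    rw [← Cardinal.lift_lt.{w, max u v}, Cardinal.lift_aleph0]
    refine lt_of_le_of_lt ?_ hκ
    rw [Cardinal.aleph0_le_lift]
    exact (le_max_left _ _).trans (Cardinal.cantor _).le
  have hG : VDef.IsSaturatedVDefinableGroup L κ U := ⟨hκ0, hsat, hU⟩
  have hone : ∀ X : Set U, VDef.IsDefinableIn L X → VDef.IsGeneric κ X →
      VDef.IsDefinableIn L (X ∪ {1}) ∧ VDef.IsGeneric κ (X ∪ {1}) ∧ (1 : U) ∈ X ∪ {1} :=
    fun X hX hXg => ⟨hX.union (VDef.isDefinableIn_singleton 1),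
      hXg.mono Set.subset_union_left, Or.inr rfl⟩
  refine ⟨fun X hX hXg => ⟨hG.stab hideal hX, rfl, hG.isTypeDefinableIn_stabNG hX hXg, ?_⟩, ?_⟩
  · obtain ⟨h1, h2, h3⟩ := hone X hX hXg
    refine lt_of_le_of_lt ?_ (hG.hasBoundedIndex_stabInf hideal hNIP hκ h1 h2 h3)
    -- Adjoining `1` to `X` gives a valid `V`; since `X ⊆ V`, the stabilizer of `X` contains
    -- `stabInf` and inherits bounded index.
    have hle : hG.stabInf hideal (X ∪ {1}) ≤ hG.stab hideal hX := fun g hg =>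
      (hG.mem_stabInf hideal).1 hg X hX Set.subset_union_left hXg
    exact Cardinal.mk_le_of_surjective (f := QuotientGroup.map _ _ (MonoidHom.id U) hle) fun q => by
      obtain ⟨g, rfl⟩ := QuotientGroup.mk_surjective q
      exact ⟨g, rfl⟩
  · obtain ⟨X, hX, hXg⟩ := hgen
    obtain ⟨h1, h2, h3⟩ := hone X hX hXg
    exact ⟨_, hG.isU00_stabInf hideal hNIP hκ h1 h2 h3⟩
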